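/- \textbf{AdWords with advice.} There is a finite set $U$ of advertisers with budgets $B_u \ge 0$, known from the start. Impressions $v \in V$ ($V$ finite, its size unknown in advance) arrive one at a time; when $v$ arrives, bids $b_{u,v} \ge 0$ and an advice $(a_{u,v})_{u \in U}$ are revealed, and the algorithm irrevocably, and possibly at random, assigns $v$ to one advertiser or to none. If $v$ is assigned to $u$, it earns $b_{u,v}$ provided that $b_{u,v}$ is at most the remaining budget of $u$, and $0$ otherwise. The advice is a feasible fractional assignment: $a_{u,v} \ge 0$, $\sum_{u} a_{u,v} \le 1$ for every $v$, and $\sum_{v} b_{u,v} a_{u,v} \le B_u$ for every $u$ (an integral advice has $a_{u,v} \in \{0,1\}$). Let $\mathsf{ALG}$ be the total revenue of the algorithm, $\mathsf{OPT}$ the largest total revenue of an integral assignment in hindsight, and $\mathsf{ADVICE} = \sum_{u,v} b_{u,v} a_{u,v}$. For a given $\varepsilon > 0$, the small-bids assumption says that $b_{u,v} \le \varepsilon B_u$ for all $u, v$. Under this assumption an algorithm is $\rho$-robust if $\mathbb{E}[\mathsf{ALG}] \ge \rho \cdot \mathsf{OPT}$, and $\kappa$-consistent if $\mathbb{E}[\mathsf{ALG}]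 \ge \kappa \cdot \mathsf{ADVICE}$, on every instance with $b_{u,v} \le \varepsilon B_u$ for all $u, v$. \textbf{Theorem.} For $\lambda \in [0,1]$ let $$r(\lambda) = 1 - e^{\lambda-1} - \left(e^{\lambda-1} - \lambda\right) \ln\left(1 - \lambda e^{1-\lambda}\right) - \lambda(1-\lambda), \qquad c(\lambda) = 1 + \lambda - e^{\lambda-1},$$ where at $\lambda = 1$ the term with the logarithm is read as $0$, so $r(1) = 0$. There is an $\varepsilon_0 > 0$ such that for every $\varepsilon \in (0, \varepsilon_0]$ and every $\lambda \in [0,1]$ there is a randomized online algorithm for AdWords with advice which, under the small-bids assumption with this $\varepsilon$, is $r(\lambda) \left(1 - 3\sqrt{\varepsilon \ln(1/\varepsilon)}\right)$-robust and $c(\lambda) \left(1 - 3\sqrt{\varepsilon \ln(1/\varepsilon)}\right)$-consistent. -/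

import Mathlib

open scoped BigOperators

noncomputable section

namespace AdWords

/-- An instance of the AdWords problem with advice: `m` advertisers with nonnegative budgets, and
`n` impressions, listed in order of arrival, on which the advertisers place nonnegative bids.
The advice is a fractional assignment of the impressions to the advertisers that is feasible in
hindsight: it splits every impression into fractions of total at most one, and respects the budgets.
An integral advice is the case in which all the fractions are 0 or 1. -/
structure Instance (m n : ℕ) where
  budget : Fin m → ℝ
  bid : Fin m → Fin n → ℝ
  advice : Fin m → Fin n → ℝ
  budget_nonneg : ∀ u, 0 ≤ budget u
  bid_nonneg : ∀ u v, 0 ≤ bid u v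
  advice_nonneg : ∀ u v, 0 ≤ advice u v
  advice_supply : ∀ v, ∑ u, advice u v ≤ 1
  advice_budget : ∀ u, ∑ v, bid u v * advice u v ≤ budget u

/-- A randomized online (integral) algorithm for AdWords with advice. The budgets of the `m`
advertisers are known from the start. When the impression number `t` (counted from 0) arrives, the
algorithm knows the bids and the advice for the impressions `0, …, t` and its own earlier decisions
for the impressions `0, …, t - 1`, and chooses at random, irrevocably, an advertiser for
impression `t`, or none. The number of impressions still to come is not known to it. -/
structure OnlineAlgorithm where
  choose : (m t : ℕ) → (budget : Fin m → ℝ) →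
    (bid : Fin m → Fin (t + 1) → ℝ) → (advice : Fin m → Fin (t + 1) → ℝ) →
    (past : Fin t → Option (Fin m)) → PMF (Option (Fin m))

namespace Instance

variable {m n : ℕ} (I : Instance m n)

/-- The small bids assumption with bid-to-budget ratio at most `ε`. -/
def SmallBids (ε : ℝ) : Prop := ∀ u v, I.bid u v ≤ ε * I.budget u

open Classical in
/-- What advertiser `u` has paid for the first `t` impressions under the assignment `σ`: an
impression assigned to `u` is paid for with the full bid if `u` can afford the bid from its
remaining budget, and with nothing otherwise. -/
def spent (σ : Fin n → Option (Fin m)) (u : Fin m) : ℕ → ℝ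
  | 0 => 0
  | t + 1 => spent σ u t +
      if h : t < n then
        if σ ⟨t, h⟩ = some u ∧ I.bid u ⟨t, h⟩ ≤ I.budget u - spent σ u t then I.bid u ⟨t, h⟩ else 0
      else 0

/-- The total revenue of an assignment. -/
def revenue (σ : Fin n → Option (Fin m)) : ℝ := ∑ u, I.spent σ u n

/-- The largest revenue of an (integral) assignment in hindsight. -/
def opt : ℝ := Finset.univ.sup' Finset.univ_nonempty I.revenue

/-- The revenue of the advice. -/
def adviceValue : ℝ := ∑ u, ∑ v, I.bid u v * I.advice u v

end Instance

namespace OnlineAlgorithm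

variable (alg : OnlineAlgorithm) {m n : ℕ} (I : Instance m n)

/-- The distribution of the decision at the arrival of impression `v`, given that the decisions
before `v` were those of `σ`. -/
def step (σ : Fin n → Option (Fin m)) (v : Fin n) : PMF (Option (Fin m)) :=
  alg.choose m v I.budget
    (fun u s => I.bid u (Fin.castLE (Nat.succ_le_of_lt v.isLt) s))
    (fun u s => I.advice u (Fin.castLE (Nat.succ_le_of_lt v.isLt) s))
    (fun s => σ (Fin.castLE v.isLt.le s))

/-- The probability that the decisions of the algorithm on the instance are exactly `σ`. -/
def runProb (σ : Fin n → Option (Fin m)) : ℝ := ∏ v, (alg.step I σ v (σ v)).toReal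

/-- The expected revenue of the algorithm on an instance. -/
def expectedRevenue : ℝ := ∑ σ : Fin n → Option (Fin m), alg.runProb I σ * I.revenue σ

/-- `ρ`-robustness on the instances with bid-to-budget ratio at most `ε`. -/
def IsRobust (ε ρ : ℝ) : Prop :=
  ∀ (m n : ℕ) (I : Instance m n), I.SmallBids ε → ρ * I.opt ≤ alg.expectedRevenue I

/-- `κ`-consistency on the instances with bid-to-budget ratio at most `ε`. -/
def IsConsistent (ε κ : ℝ) : Prop :=
  ∀ (m n : ℕ) (I : Instance m n), I.SmallBids ε → κ * I.adviceValue ≤ alg.expectedRevenue I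

end OnlineAlgorithm

/-- The robustness `r(l)`, where `l` is the tradeoff parameter. At `l = 1` the product of
`exp (l - 1) - l = 0` and the logarithm of 0 is 0, its limit as `l` tends to 1. -/
def robustness (l : ℝ) : ℝ :=
  1 - Real.exp (l - 1) - (Real.exp (l - 1) - l) * Real.log (1 - l * Real.exp (1 - l)) - l * (1 - l)

/-- The consistency `c(l)`, where `l` is the tradeoff parameter. -/
def consistency (l : ℝ) : ℝ := 1 + l - Real.exp (l - 1)

/-- The loss factor `1 - 3 √(ε ln (1/ε))`. -/
def smallBidsFactor (ε : ℝ) : ℝ := 1 - 3 * Real.sqrt (ε * Real.log (1 / ε))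

end AdWords

end

open scoped BigOperators

noncomputable section

namespace AdWords

/-! A deterministic greedy algorithm builds a fractional assignment, and independent rounding makes
it integral. The greedy gives each small part of an impression to the advertiser of largest positive
score, the bid times `1 - f A X`, where `A` and `X` are the loads, relative to the budget, from the
advice and from the algorithm. As in primal-dual proofs, an earned bid `w` splits into `w * f`,
credited to the advertiser, and `w * (1 - f)`, credited to the impression. The impression's credit
dominates what any fractional assignment scores there (`sum_score_le`), so it remains to bound the
advertisers' credits from below. The potential `V` bounds the credit plus the scores collected by
the advice and yields consistency (`consistency_greedy`); `W` bounds the credit alone and yields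
robustness (`robustness_greedy`).

For `l < 1` put `k = exp (l - 1) - l`, so that `c(l) = 1 - k`. The penalty (`tradeoffSystem`) is the
maximum of an exponential in the excess `X - A`, which jumps from 0 to `exp (l - 1)` when the excess
becomes positive, and of a function `g` of `X` alone that rises from `k` to 1 on `[0, 1]`. The shape
of `g` makes the estimate behind consistency tight (`exists_threshold`), and the area under `g` is
`r(l)` (`levelCredit_one`). `V` is computed along the path that raises first `X` and then `A`, which
is the worst order by `integral_exchange_le`. At `l = 1` robustness is void and `followAdvice`
suffices.

With `e = √ε`, impressions are cut into `N` parts and the penalty is averaged over `N` shifts by `e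
^ 2 / N`. This removes the effect of the jump at a cost of `1 / N` in both ratios and of a relative
budget excess `e ^ 2`. Rounding with probabilities `(1 - e) x` leaves room of order `e` for
fluctuations, and a variance bound gives the factor `1 - 2 * e` (`rounding_lower_bound`). For large
`N` the total factor is at least `1 - 3 * e`, and `ln (1 / ε) ≥ 1`. -/

/-- A penalty `f A X` for an advertiser of unit budget to which the advice has assigned `A` and the
algorithm `X`, with potentials `V` and `W` that certify consistency `c` and robustness `r` of the
greedy algorithm which maximizes the bids discounted by `1 - f`. -/
structure PenaltySystem (r c cap : ℝ) where
  f : ℝ → ℝ → ℝ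
  V : ℝ → ℝ → ℝ
  W : ℝ → ℝ → ℝ
  f_nonneg : ∀ A X, 0 ≤ f A X
  f_le_one : ∀ A X, f A X ≤ 1
  f_mono : ∀ A, Monotone (f A)
  f_eq_one : ∀ A X, 0 ≤ A → A ≤ 1 → cap < X → f A X = 1
  V_zero : V 0 0 = 0
  -- An assignment of `h` is charged the penalty at the final load `X + h`, as in the score of the
  -- greedy algorithm.
  V_push : ∀ A X h, 0 ≤ A → A ≤ 1 → 0 ≤ X → 0 ≤ h → V A (X + h) ≤ V A X + h * f A (X + h)
  -- Here the penalty is taken at the load before the assignment; the discrepancy with the score is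
  -- what smoothing has to control.
  V_advice : ∀ A A' X, 0 ≤ A → A ≤ A' → A' ≤ 1 → 0 ≤ X →
    V A' X ≤ V A X + (A' - A) * (1 - f A' X)
  V_lower : ∀ A X, 0 ≤ A → A ≤ 1 → 0 ≤ X → c * A ≤ V A X
  W_zero : W 0 0 = 0
  W_push : ∀ A X h, 0 ≤ A → A ≤ 1 → 0 ≤ X → 0 ≤ h → W A (X + h) ≤ W A X + h * f A (X + h)
  W_advice : ∀ A A' X, 0 ≤ A → A ≤ A' → A' ≤ 1 → 0 ≤ X → W A' X ≤ W A X
  W_lower : ∀ A X, 0 ≤ A → A ≤ 1 → 0 ≤ X → r ≤ W A X + 1 - f A X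

/-! ### Penalty systems: following the advice, and smoothing by averaged shifts -/

namespace PenaltySystem

/-- The system that follows the advice and guarantees no robustness. -/
def followAdvice : PenaltySystem 0 1 1 where
  f A X := if A < X then 1 else 0
  V A X := max A X
  W _ _ := 0
  f_nonneg A X := by split_ifs <;> norm_num
  f_le_one A X := by split_ifs <;> norm_num
  f_mono A X Y h := by
    dsimp only
    split_ifs with h₁ h₂ <;> first | (exfalso; linarith) | norm_num
  f_eq_one A X h0 h1 h := by rw [if_pos (by linarith)]
  V_zero := by simp
  V_push A X h _ _ _ hh := by
    split_ifs with h₁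
    · rcases le_total A X with h₂ | h₂
      · rw [max_eq_right h₂, max_eq_right h₁.le]; linarith
      · rw [max_eq_left h₂, max_eq_right h₁.le]; linarith
    · rw [max_eq_left (by linarith), max_eq_left (by linarith)]; linarith
  V_advice A A' X _ h _ _ := by
    split_ifs with h₁
    · rw [max_eq_right h₁.le, max_eq_right (by linarith)]; linarith
    · rw [max_eq_left (by linarith)]
      have := le_max_left A X
      linarith
  V_lower A X _ _ _ := by rw [one_mul]; exact le_max_left A X
  W_zero := rfl
  W_push A X h _ _ _ hh := by split_ifs <;> simp [hh]
  W_advice _ _ _ _ _ _ _ := le_rfl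
  W_lower A X _ _ _ := by split_ifs <;> norm_num

variable {r c cap : ℝ}

theorem V_push_le (P : PenaltySystem r c cap) {A X Y : ℝ} (hA : 0 ≤ A) (hA1 : A ≤ 1) (hX : 0 ≤ X)
    (hXY : X ≤ Y) : P.V A Y ≤ P.V A X + (Y - X) * P.f A Y := by
  simpa using P.V_push A X (Y - X) hA hA1 hX (by linarith)

theorem W_push_le (P : PenaltySystem r c cap) {A X Y : ℝ} (hA : 0 ≤ A) (hA1 : A ≤ 1) (hX : 0 ≤ X)
    (hXY : X ≤ Y) : P.W A Y ≤ P.W A X + (Y - X) * P.f A Y := by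
  simpa using P.W_push A X (Y - X) hA hA1 hX (by linarith)

/-- The average of `F A` over `K` backward shifts by multiples of `s`. -/
def shiftAverage (K : ℕ) (s : ℝ) (F : ℝ → ℝ → ℝ) (A X : ℝ) : ℝ :=
  (∑ i ∈ Finset.range K, F A (max (X - i * s) 0)) / K

theorem shiftAverage_zero (K : ℕ) {s : ℝ} (hs : 0 ≤ s) (F : ℝ → ℝ → ℝ) (hF : F 0 0 = 0) :
    shiftAverage K s F 0 0 = 0 := by
  unfold shiftAverage
  rw [Finset.sum_eq_zero, zero_div]
  intro i _
  rw [max_eq_right (by simp only [zero_sub, Left.neg_nonpos_iff]; positivity), hF]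

theorem le_shiftAverage {K : ℕ} (hK : 0 < K) {s b A X : ℝ} {F : ℝ → ℝ → ℝ}
    (h : ∀ i < K, b ≤ F A (max (X - i * s) 0)) : b ≤ shiftAverage K s F A X := by
  have hK' : (0 : ℝ) < K := by exact_mod_cast hK
  unfold shiftAverage
  rw [le_div_iff₀ hK']
  calc b * K = ∑ i ∈ Finset.range K, b := by simp [mul_comm]
    _ ≤ _ := Finset.sum_le_sum fun i hi => h i (Finset.mem_range.1 hi)

theorem shiftAverage_le {K : ℕ} (hK : 0 < K) {s b A X : ℝ} {F : ℝ → ℝ → ℝ}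
    (h : ∀ i < K, F A (max (X - i * s) 0) ≤ b) : shiftAverage K s F A X ≤ b := by
  have hK' : (0 : ℝ) < K := by exact_mod_cast hK
  unfold shiftAverage
  rw [div_le_iff₀ hK']
  calc _ ≤ ∑ i ∈ Finset.range K, b := Finset.sum_le_sum fun i hi => h i (Finset.mem_range.1 hi)
    _ = b * K := by simp [mul_comm]

/-- The inequality is linear and invariant under shifts; clipping at 0 only shortens a step, which
is harmless because the penalty is nonnegative. -/
theorem shiftAverage_push {K : ℕ} (hK : 0 < K) {s : ℝ} {F f : ℝ → ℝ → ℝ} {A X h : ℝ} (hh : 0 ≤ h)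
    (hf : ∀ X, 0 ≤ f A X)
    (hF : ∀ X Y, 0 ≤ X → X ≤ Y → F A Y ≤ F A X + (Y - X) * f A Y) :
    shiftAverage K s F A (X + h) ≤ shiftAverage K s F A X + h * shiftAverage K s f A (X + h) := by
  have hK' : (0 : ℝ) < K := by exact_mod_cast hK
  unfold shiftAverage
  rw [← mul_div_assoc, ← add_div, Finset.mul_sum, ← Finset.sum_add_distrib]
  gcongr with i _
  have h1 : max (X - i * s) 0 ≤ max (X + h - i * s) 0 := max_le_max (by linarith) le_rfl
  have h2 : max (X + h - i * s) 0 - max (X - i * s) 0 ≤ h := by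
    rcases le_total (X + h - i * s) 0 with h3 | h3
    · rw [max_eq_right h3]; have := le_max_right (X - i * s) 0; linarith
    · rw [max_eq_left h3]; have := le_max_left (X - i * s) 0; linarith
  refine (hF _ _ (le_max_right _ _) h1).trans ?_
  gcongr
  exact hf _

/-- Averaging a penalty over `K` shifts by multiples of `s`: by `shiftAverage_add_le` it then grows
by at most `1 / K` over an interval of length `s`. -/
def smooth (P : PenaltySystem r c cap) {K : ℕ} (hK : 0 < K) {s : ℝ} (hs : 0 ≤ s) :
    PenaltySystem r c (cap + K * s) where
  f := shiftAverage K s P.f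
  V := shiftAverage K s P.V
  W := shiftAverage K s P.W
  f_nonneg A X := le_shiftAverage hK fun _ _ => P.f_nonneg _ _
  f_le_one A X := shiftAverage_le hK fun _ _ => P.f_le_one _ _
  f_mono A X Y h := by
    unfold shiftAverage
    gcongr with i _
    exact P.f_mono A (max_le_max (by linarith) le_rfl)
  f_eq_one A X hA hA1 h := by
    refine le_antisymm (shiftAverage_le hK fun _ _ => P.f_le_one _ _)
      (le_shiftAverage hK fun i hi => (P.f_eq_one _ _ hA hA1 ?_).ge)
    have : (i : ℝ) * s ≤ K * s := by gcongr
    exact lt_max_of_lt_left (by linarith)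
  V_zero := shiftAverage_zero K hs _ P.V_zero
  V_push A X h hA hA1 _ hh := shiftAverage_push hK hh (P.f_nonneg A)
    fun _ _ hX hXY => P.V_push_le hA hA1 hX hXY
  V_advice A A' X hA hAA hA1 _ := by
    have hK' : (0 : ℝ) < K := by exact_mod_cast hK
    have : shiftAverage K s P.V A X + (A' - A) * (1 - shiftAverage K s P.f A' X)
        = (∑ i ∈ Finset.range K, (P.V A (max (X - i * s) 0)
          + (A' - A) * (1 - P.f A' (max (X - i * s) 0)))) / K := by
      unfold shiftAverage
      rw [Finset.sum_add_distrib, ← Finset.mul_sum, Finset.sum_sub_distrib]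
      simp only [Finset.sum_const, Finset.card_range, nsmul_eq_mul, mul_one]
      generalize ∑ i ∈ Finset.range K, P.V A (max (X - i * s) 0) = v
      generalize ∑ i ∈ Finset.range K, P.f A' (max (X - i * s) 0) = w
      field_simp
    rw [this]
    unfold shiftAverage
    gcongr with i _
    exact P.V_advice A A' _ hA hAA hA1 (le_max_right _ _)
  V_lower A X hA hA1 _ := le_shiftAverage hK fun _ _ => P.V_lower _ _ hA hA1 (le_max_right _ _)
  W_zero := shiftAverage_zero K hs _ P.W_zero
  W_push A X h hA hA1 _ hh := shiftAverage_push hK hh (P.f_nonneg A)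
    fun _ _ hX hXY => P.W_push_le hA hA1 hX hXY
  W_advice A A' X hA hAA hA1 _ := by
    unfold shiftAverage
    gcongr with i _
    exact P.W_advice A A' _ hA hAA hA1 (le_max_right _ _)
  W_lower A X hA hA1 _ := by
    have hK' : (0 : ℝ) < K := by exact_mod_cast hK
    have : shiftAverage K s P.W A X + 1 - shiftAverage K s P.f A X
        = shiftAverage K s (fun A X => P.W A X + 1 - P.f A X) A X := by
      unfold shiftAverage
      rw [Finset.sum_sub_distrib, Finset.sum_add_distrib]
      simp only [Finset.sum_const, Finset.card_range, nsmul_eq_mul, mul_one]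
      generalize ∑ i ∈ Finset.range K, P.W A (max (X - i * s) 0) = v
      generalize ∑ i ∈ Finset.range K, P.f A (max (X - i * s) 0) = w
      field_simp
    rw [this]
    exact le_shiftAverage hK fun _ _ => P.W_lower _ _ hA hA1 (le_max_right _ _)

/-- Moving by exactly `s` permutes the shifts: the two averages share all summands but one, and that
one changes by at most 1. -/
theorem smooth_slow (P : PenaltySystem r c cap) {K : ℕ} (hK : 0 < K) {s : ℝ} (hs : 0 ≤ s)
    {A X h : ℝ} (hh : h ≤ s) :
    (P.smooth hK hs).f A (X + h) ≤ (P.smooth hK hs).f A X + 1 / K := by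
  refine ((P.smooth hK hs).f_mono A (add_le_add_right hh X)).trans ?_
  change shiftAverage K s P.f A (X + s) ≤ shiftAverage K s P.f A X + 1 / K
  unfold shiftAverage
  rw [← add_div]
  gcongr
  obtain ⟨K, rfl⟩ := Nat.exists_eq_succ_of_ne_zero hK.ne'
  rw [Finset.sum_range_succ', Finset.sum_range_succ]
  have h1 : ∀ i ∈ Finset.range K, P.f A (max (X + s - ((i + 1 : ℕ) : ℝ) * s) 0)
      = P.f A (max (X - i * s) 0) := fun i _ => by
    congr 2; push_cast; ring
  rw [Finset.sum_congr rfl h1]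
  have h2 := P.f_le_one A (max (X + s - ((0 : ℕ) : ℝ) * s) 0)
  have h3 := P.f_nonneg A (max (X - (K : ℝ) * s) 0)
  linarith

end PenaltySystem

/-! ### The greedy algorithm and the splitting of its revenue into credits -/

section Greedy

variable {ι : Type*}

open Classical in
/-- An index of the largest score, provided that it is positive. -/
def pick (s : ι → ℝ) : Option ι :=
  if h : ∃ u, 0 < s u ∧ ∀ u', s u' ≤ s u then some h.choose else none

/-- The larger of 0 and the largest score. -/
def bestScore (s : ι → ℝ) : ℝ := (pick s).elim 0 s

theorem pos_of_pick_eq_some {s : ι → ℝ} {u : ι} (h : pick s = some u) : 0 < s u := by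
  unfold pick at h
  split_ifs at h with h'
  rw [← Option.some.inj h]
  exact h'.choose_spec.1

theorem bestScore_nonneg (s : ι → ℝ) : 0 ≤ bestScore s := by
  unfold bestScore
  rcases h : pick s with _ | u
  · exact le_rfl
  · exact (pos_of_pick_eq_some h).le

theorem le_bestScore [Finite ι] (s : ι → ℝ) (u : ι) : s u ≤ bestScore s := by
  unfold bestScore pick
  split_ifs with h
  · exact h.choose_spec.2 u
  · by_contra! hu
    have : Nonempty ι := ⟨u⟩
    obtain ⟨v, hv⟩ := Finite.exists_max s
    exact h ⟨v, (by simpa using hu : 0 < s u).trans_le (hv u), hv⟩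

theorem sum_pick [Fintype ι] [DecidableEq ι] (s : ι → ℝ) :
    ∑ u, (if pick s = some u then s u else 0) = bestScore s := by
  unfold bestScore
  rcases pick s with _ | u <;> simp

/-- What the advice has assigned to `u` before time `t`. -/
def adviceLoad (w a : ℕ → ι → ℝ) (t : ℕ) (u : ι) : ℝ := ∑ i ∈ Finset.range t, w i u * a i u

/-- The penalty of `u` at time `t`, if the algorithm has assigned `S` to `u` so far. -/
def penalty (f : ℝ → ℝ → ℝ) (B : ι → ℝ) (w a : ℕ → ι → ℝ) (t : ℕ) (S : ℝ) (u : ι) : ℝ :=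
  f (adviceLoad w a (t + 1) u / B u) ((S + w t u) / B u)

open Classical in
/-- What the greedy algorithm has assigned to `u` before time `t`. -/
def greedyLoad (f : ℝ → ℝ → ℝ) (B : ι → ℝ) (w a : ℕ → ι → ℝ) : ℕ → ι → ℝ
  | 0 => fun _ => 0
  | t + 1 => fun u => greedyLoad f B w a t u +
      if pick (fun v => w t v * (1 - penalty f B w a t (greedyLoad f B w a t v) v)) = some u
      then w t u else 0

/-- The bids at time `t`, discounted by the penalties. -/
def greedyScore (f : ℝ → ℝ → ℝ) (B : ι → ℝ) (w a : ℕ → ι → ℝ) (t : ℕ) (u : ι) : ℝ :=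
  w t u * (1 - penalty f B w a t (greedyLoad f B w a t u) u)

/-- The greedy choice at time `t`. -/
def greedyPick (f : ℝ → ℝ → ℝ) (B : ι → ℝ) (w a : ℕ → ι → ℝ) (t : ℕ) : Option ι :=
  pick (greedyScore f B w a t)

variable {f : ℝ → ℝ → ℝ} {B : ι → ℝ} {w a : ℕ → ι → ℝ}

open Classical in
theorem greedyLoad_succ (t : ℕ) (u : ι) : greedyLoad f B w a (t + 1) u =
    greedyLoad f B w a t u + if greedyPick f B w a t = some u then w t u else 0 := rfl

open Classical in
theorem greedyLoad_eq_sum (t : ℕ) (u : ι) : greedyLoad f B w a t u =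
    ∑ i ∈ Finset.range t, if greedyPick f B w a i = some u then w i u else 0 := by
  induction t with
  | zero => rfl
  | succ t ih => rw [Finset.sum_range_succ, ← ih, greedyLoad_succ]

theorem adviceLoad_congr {w' a' : ℕ → ι → ℝ} {t : ℕ} (hw : ∀ i < t, w i = w' i)
    (ha : ∀ i < t, a i = a' i) : adviceLoad w a t = adviceLoad w' a' t := by
  funext u
  refine Finset.sum_congr rfl fun i hi => ?_
  rw [hw i (Finset.mem_range.1 hi), ha i (Finset.mem_range.1 hi)]

theorem greedyLoad_congr {w' a' : ℕ → ι → ℝ} {t : ℕ} (hw : ∀ i < t, w i = w' i)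
    (ha : ∀ i < t, a i = a' i) : greedyLoad f B w a t = greedyLoad f B w' a' t := by
  induction t with
  | zero => rfl
  | succ t ih =>
    have ih' := ih (fun i hi => hw i (by omega)) (fun i hi => ha i (by omega))
    have hp : greedyPick f B w a t = greedyPick f B w' a' t := by
      unfold greedyPick greedyScore penalty
      rw [ih', adviceLoad_congr hw ha, hw t t.lt_succ_self]
    funext u
    rw [greedyLoad_succ, greedyLoad_succ, hp, ih', hw t t.lt_succ_self]

/-- This is what makes the greedy algorithm online. -/
theorem greedyPick_congr {w' a' : ℕ → ι → ℝ} {t : ℕ} (hw : ∀ i ≤ t, w i = w' i)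
    (ha : ∀ i ≤ t, a i = a' i) : greedyPick f B w a t = greedyPick f B w' a' t := by
  unfold greedyPick greedyScore penalty
  rw [greedyLoad_congr (fun i hi => hw i (le_of_lt hi)) (fun i hi => ha i (le_of_lt hi)),
    adviceLoad_congr (fun i hi => hw i (Nat.lt_succ_iff.1 hi))
      (fun i hi => ha i (Nat.lt_succ_iff.1 hi)), hw t le_rfl]

theorem greedyLoad_nonneg (hw : ∀ t u, 0 ≤ w t u) (t : ℕ) (u : ι) : 0 ≤ greedyLoad f B w a t u := by
  classical
  rw [greedyLoad_eq_sum]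
  refine Finset.sum_nonneg fun i _ => ?_
  split_ifs
  exacts [hw i u, le_rfl]

theorem adviceLoad_nonneg (hw : ∀ t u, 0 ≤ w t u) (ha : ∀ t u, 0 ≤ a t u) (t : ℕ) (u : ι) :
    0 ≤ adviceLoad w a t u :=
  Finset.sum_nonneg fun i _ => mul_nonneg (hw i u) (ha i u)

theorem adviceLoad_mono (hw : ∀ t u, 0 ≤ w t u) (ha : ∀ t u, 0 ≤ a t u) (u : ι) :
    Monotone fun t => adviceLoad w a t u := by
  refine monotone_nat_of_le_succ fun t => ?_
  simp only [adviceLoad, Finset.sum_range_succ]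
  have := mul_nonneg (hw t u) (ha t u)
  linarith

open Classical in
/-- The part of the revenue from `u` before time `t` that is credited to `u`. -/
def credit (f : ℝ → ℝ → ℝ) (B : ι → ℝ) (w a : ℕ → ι → ℝ) (t : ℕ) (u : ι) : ℝ :=
  ∑ i ∈ Finset.range t, if greedyPick f B w a i = some u
    then w i u * penalty f B w a i (greedyLoad f B w a i u) u else 0

/-- The rest of the revenue is credited to the impressions. -/
theorem sum_greedyLoad [Fintype ι] (t : ℕ) : ∑ u, greedyLoad f B w a t u =
    ∑ u, credit f B w a t u + ∑ i ∈ Finset.range t, bestScore (greedyScore f B w a i) := by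
  classical
  rw [Finset.sum_congr rfl fun u _ => greedyLoad_eq_sum t u]
  simp only [credit, ← sum_pick]
  rw [Finset.sum_comm, Finset.sum_comm (s := (Finset.univ : Finset ι)), ← Finset.sum_add_distrib]
  refine Finset.sum_congr rfl fun i _ => ?_
  rw [← Finset.sum_add_distrib]
  refine Finset.sum_congr rfl fun u _ => ?_
  unfold greedyPick
  split_ifs
  · unfold greedyScore; ring
  · simp

/-- Any fractional assignment collects at most the credits of the impressions. -/
theorem sum_score_le [Fintype ι] {o : ℕ → ι → ℝ} (ho : ∀ t u, 0 ≤ o t u)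
    (ho1 : ∀ t, ∑ u, o t u ≤ 1) (T : ℕ) :
    ∑ u, ∑ i ∈ Finset.range T, o i u * greedyScore f B w a i u ≤
      ∑ i ∈ Finset.range T, bestScore (greedyScore f B w a i) := by
  rw [Finset.sum_comm]
  refine Finset.sum_le_sum fun i _ => ?_
  calc _ ≤ ∑ u, o i u * bestScore (greedyScore f B w a i) := by
        gcongr with u _
        · exact ho i u
        · exact le_bestScore _ u
    _ = (∑ u, o i u) * bestScore (greedyScore f B w a i) := (Finset.sum_mul ..).symm
    _ ≤ 1 * bestScore (greedyScore f B w a i) := by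
        gcongr
        · exact bestScore_nonneg _
        · exact ho1 i
    _ = _ := one_mul _

end Greedy

/-! ### Potentials bound the credits: consistency and robustness of the greedy algorithm -/

section Guarantees

variable {ι : Type*} {B : ι → ℝ} {w a : ℕ → ι → ℝ} {r c cap s η : ℝ} {P : PenaltySystem r c cap}

theorem credit_mono (hw : ∀ t u, 0 ≤ w t u) (u : ι) : Monotone fun t => credit P.f B w a t u := by
  classical
  refine monotone_nat_of_le_succ fun t => ?_
  simp only [credit, Finset.sum_range_succ]
  split_ifs
  · have := mul_nonneg (hw t u) (P.f_nonneg (adviceLoad w a (t + 1) u / B u)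
      ((greedyLoad P.f B w a t u + w t u) / B u))
    unfold penalty
    linarith
  · simp

/-- The greedy algorithm exceeds no budget by more than the factor `cap`. -/
theorem greedyLoad_le (hw : ∀ t u, 0 ≤ w t u) (ha : ∀ t u, 0 ≤ a t u) {u : ι} (hB : 0 < B u)
    (hcap : 0 ≤ cap) {T : ℕ} (haB : adviceLoad w a T u ≤ B u) :
    greedyLoad P.f B w a T u ≤ cap * B u := by
  classical
  suffices ∀ t ≤ T, greedyLoad P.f B w a t u ≤ cap * B u from this T le_rfl
  intro t ht
  induction t with
  | zero => exact mul_nonneg hcap hB.le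
  | succ t ih =>
    rw [greedyLoad_succ]
    split_ifs with h
    · have h1 := pos_of_pick_eq_some h
      -- Beyond `cap` the penalty would be 1 and the score 0, but picked scores are positive.
      by_contra! h2
      have h3 : penalty P.f B w a t (greedyLoad P.f B w a t u) u = 1 := by
        refine P.f_eq_one _ _ (div_nonneg (adviceLoad_nonneg hw ha _ u) hB.le) ?_ ?_
        · rw [div_le_one hB]; exact (adviceLoad_mono hw ha u ht).trans haB
        · rwa [lt_div_iff₀ hB]
      rw [greedyScore, h3] at h1
      simp at h1
    · simpa using ih (by omega)

/-- Each time step moves the pair of loads first by the advice, at no gain of `W`, then by the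
assignment, where the gain of `W` is at most the new credit. -/
theorem mul_W_le_credit (hw : ∀ t u, 0 ≤ w t u) (ha : ∀ t u, 0 ≤ a t u) {u : ι} (hB : 0 < B u)
    {T : ℕ} (haB : adviceLoad w a T u ≤ B u) :
    ∀ t ≤ T, B u * P.W (adviceLoad w a t u / B u) (greedyLoad P.f B w a t u / B u)
      ≤ credit P.f B w a t u := by
  classical
  intro t
  induction t with
  | zero => intro _; simp [adviceLoad, greedyLoad, credit, P.W_zero]
  | succ t ih =>
    intro ht
    have hA := div_nonneg (adviceLoad_nonneg hw ha t u) hB.le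
    have hA1 : adviceLoad w a (t + 1) u / B u ≤ 1 := by
      rw [div_le_one hB]; exact (adviceLoad_mono hw ha u ht).trans haB
    have hAA : adviceLoad w a t u / B u ≤ adviceLoad w a (t + 1) u / B u := by
      gcongr; exact adviceLoad_mono hw ha u t.le_succ
    have hX : 0 ≤ greedyLoad P.f B w a t u / B u := div_nonneg (greedyLoad_nonneg hw t u) hB.le
    have h1 := P.W_advice _ _ _ hA hAA hA1 hX
    have h2 := ih (by omega)
    have h3 := P.W_push _ _ (w t u / B u) (hA.trans hAA) hA1 hX (div_nonneg (hw t u) hB.le)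
    have h1' := mul_le_mul_of_nonneg_left h1 hB.le
    have h3' := mul_le_mul_of_nonneg_left h3 hB.le
    rw [greedyLoad_succ, credit, Finset.sum_range_succ, ← credit]
    split_ifs with h
    · rw [add_div]
      refine h3'.trans ?_
      have : B u * (w t u / B u * P.f (adviceLoad w a (t + 1) u / B u)
          (greedyLoad P.f B w a t u / B u + w t u / B u))
          = w t u * penalty P.f B w a t (greedyLoad P.f B w a t u) u := by
        rw [penalty, add_div]; field_simp
      rw [mul_add, this]
      linarith
    · rw [add_zero, add_zero]
      linarith

/-- As for `W`, except that a move of the advice is paid for by the score that the advice collects.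
That score uses the penalty after a tentative assignment, whence an error `η` per unit of advice
load. -/
theorem mul_V_le_credit (hw : ∀ t u, 0 ≤ w t u) (ha : ∀ t u, 0 ≤ a t u) {u : ι} (hB : 0 < B u)
    (hs : ∀ t, w t u ≤ s * B u) (hP : ∀ A X h, h ≤ s → P.f A (X + h) ≤ P.f A X + η)
    {T : ℕ} (haB : adviceLoad w a T u ≤ B u) :
    ∀ t ≤ T, B u * P.V (adviceLoad w a t u / B u) (greedyLoad P.f B w a t u / B u)
      ≤ credit P.f B w a t u + ∑ i ∈ Finset.range t, a i u * greedyScore P.f B w a i u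
        + η * adviceLoad w a t u := by
  classical
  intro t
  induction t with
  | zero => intro _; simp [adviceLoad, greedyLoad, credit, P.V_zero]
  | succ t ih =>
    intro ht
    have hA := div_nonneg (adviceLoad_nonneg hw ha t u) hB.le
    have hA1 : adviceLoad w a (t + 1) u / B u ≤ 1 := by
      rw [div_le_one hB]; exact (adviceLoad_mono hw ha u ht).trans haB
    have hAA : adviceLoad w a t u / B u ≤ adviceLoad w a (t + 1) u / B u := by
      gcongr; exact adviceLoad_mono hw ha u t.le_succ
    have hX : 0 ≤ greedyLoad P.f B w a t u / B u := div_nonneg (greedyLoad_nonneg hw t u) hB.le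
    have h1 := P.V_advice _ _ _ hA hAA hA1 hX
    have h2 := ih (by omega)
    have h3 := P.V_push _ _ (w t u / B u) (hA.trans hAA) hA1 hX (div_nonneg (hw t u) hB.le)
    have h4 : penalty P.f B w a t (greedyLoad P.f B w a t u) u
        ≤ P.f (adviceLoad w a (t + 1) u / B u) (greedyLoad P.f B w a t u / B u) + η := by
      rw [penalty, add_div]
      exact hP _ _ _ (by rw [div_le_iff₀ hB]; exact hs t)
    have h5 : adviceLoad w a (t + 1) u = adviceLoad w a t u + w t u * a t u :=
      Finset.sum_range_succ _ _
    have h1' := mul_le_mul_of_nonneg_left h1 hB.le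
    have h3' := mul_le_mul_of_nonneg_left h3 hB.le
    have h6 : B u * ((adviceLoad w a (t + 1) u / B u - adviceLoad w a t u / B u)
        * (1 - P.f (adviceLoad w a (t + 1) u / B u) (greedyLoad P.f B w a t u / B u)))
        = w t u * a t u
        * (1 - P.f (adviceLoad w a (t + 1) u / B u) (greedyLoad P.f B w a t u / B u)) := by
      rw [← sub_div, h5, add_sub_cancel_left, ← mul_assoc, mul_div_cancel₀ _ hB.ne']
    have h7 : w t u * a t u
        * (1 - P.f (adviceLoad w a (t + 1) u / B u) (greedyLoad P.f B w a t u / B u))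
        ≤ a t u * greedyScore P.f B w a t u + η * (w t u * a t u) := by
      have := mul_le_mul_of_nonneg_left h4 (mul_nonneg (hw t u) (ha t u))
      rw [greedyScore]
      linarith
    rw [mul_add, h6] at h1'
    have h8 : η * adviceLoad w a (t + 1) u = η * adviceLoad w a t u + η * (w t u * a t u) := by
      rw [h5, mul_add]
    rw [Finset.sum_range_succ, h8, greedyLoad_succ, credit, Finset.sum_range_succ, ← credit]
    split_ifs with h
    · rw [add_div]
      refine h3'.trans ?_
      have : B u * (w t u / B u * P.f (adviceLoad w a (t + 1) u / B u)
          (greedyLoad P.f B w a t u / B u + w t u / B u))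
          = w t u * penalty P.f B w a t (greedyLoad P.f B w a t u) u := by
        rw [penalty, add_div]; field_simp
      rw [mul_add, this]
      linarith
    · rw [add_zero, add_zero]
      linarith

theorem credit_nonneg (hw : ∀ t u, 0 ≤ w t u) (t : ℕ) (u : ι) : 0 ≤ credit P.f B w a t u := by
  simpa [credit] using credit_mono (P := P) (B := B) (a := a) hw u (Nat.zero_le t)

/-- Consistency of the greedy algorithm. -/
theorem consistency_greedy [Fintype ι] (hw : ∀ t u, 0 ≤ w t u) (ha : ∀ t u, 0 ≤ a t u)
    (hB : ∀ u, 0 ≤ B u) (hs : ∀ t u, w t u ≤ s * B u)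
    (hP : ∀ A X h, h ≤ s → P.f A (X + h) ≤ P.f A X + η) {T : ℕ}
    (ha1 : ∀ t, ∑ u, a t u ≤ 1) (haB : ∀ u, adviceLoad w a T u ≤ B u) :
    (c - η) * ∑ u, adviceLoad w a T u ≤ ∑ u, greedyLoad P.f B w a T u := by
  rw [sum_greedyLoad, Finset.mul_sum]
  refine le_trans ?_ (add_le_add_right (sum_score_le ha ha1 T) _)
  rw [← Finset.sum_add_distrib]
  refine Finset.sum_le_sum fun u _ => ?_
  rcases (hB u).eq_or_lt with h0 | h0
  -- Without budget all bids vanish, and so do both sides.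
  · have hw0 : ∀ t, w t u = 0 := fun t => le_antisymm (by simpa [← h0] using hs t u) (hw t u)
    simp [adviceLoad, greedyScore, credit, hw0]
  · have h1 := mul_V_le_credit (P := P) hw ha h0 (fun t => hs t u) hP (haB u) T le_rfl
    have h2 := P.V_lower (adviceLoad w a T u / B u) (greedyLoad P.f B w a T u / B u)
      (div_nonneg (adviceLoad_nonneg hw ha T u) h0.le) (by rw [div_le_one h0]; exact haB u)
      (div_nonneg (greedyLoad_nonneg hw T u) h0.le)
    have h3 := mul_le_mul_of_nonneg_left h2 h0.le
    have h4 : B u * (c * (adviceLoad w a T u / B u)) = c * adviceLoad w a T u := by field_simp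
    linarith

/-- Robustness of the greedy algorithm. -/
theorem robustness_greedy [Fintype ι] (hw : ∀ t u, 0 ≤ w t u) (ha : ∀ t u, 0 ≤ a t u)
    (hB : ∀ u, 0 ≤ B u) (hs : ∀ t u, w t u ≤ s * B u)
    (hP : ∀ A X h, h ≤ s → P.f A (X + h) ≤ P.f A X + η) {T : ℕ}
    (haB : ∀ u, adviceLoad w a T u ≤ B u) {o : ℕ → ι → ℝ} (ho : ∀ t u, 0 ≤ o t u)
    (ho1 : ∀ t, ∑ u, o t u ≤ 1) (hoB : ∀ u, adviceLoad w o T u ≤ B u) :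
    (r - η) * ∑ u, adviceLoad w o T u ≤ ∑ u, greedyLoad P.f B w a T u := by
  rw [sum_greedyLoad, Finset.mul_sum]
  refine le_trans ?_ (add_le_add_right (sum_score_le ho ho1 T) _)
  rw [← Finset.sum_add_distrib]
  refine Finset.sum_le_sum fun u _ => ?_
  rcases (hB u).eq_or_lt with h0 | h0
  · have hw0 : ∀ t, w t u = 0 := fun t => le_antisymm (by simpa [← h0] using hs t u) (hw t u)
    simp [adviceLoad, greedyScore, credit, hw0]
  · set C := credit P.f B w a T u
    -- The final credit `C` is spread over the load of `o`, which is at most `B u`, at the rate `C /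
    -- B u`; it then suffices to bound each impression separately.
    have hC : adviceLoad w o T u * (C / B u) ≤ C := by
      calc _ ≤ B u * (C / B u) := by
            gcongr
            · exact div_nonneg (credit_nonneg hw T u) h0.le
            · exact hoB u
        _ = C := by field_simp
    refine le_trans ?_ (add_le_add_left hC _)
    rw [adviceLoad, Finset.mul_sum, Finset.sum_mul, ← Finset.sum_add_distrib]
    refine Finset.sum_le_sum fun i hi => ?_
    have hi := Finset.mem_range.1 hi
    have hA1 : adviceLoad w a (i + 1) u / B u ≤ 1 := by
      rw [div_le_one h0]; exact (adviceLoad_mono hw ha u hi).trans (haB u)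
    have hA := div_nonneg (adviceLoad_nonneg hw ha i u) h0.le
    have hAA : adviceLoad w a i u / B u ≤ adviceLoad w a (i + 1) u / B u := by
      gcongr; exact adviceLoad_mono hw ha u i.le_succ
    have hX : 0 ≤ greedyLoad P.f B w a i u / B u := div_nonneg (greedyLoad_nonneg hw i u) h0.le
    -- The potential at time `i` is compared with the final credit, since credits only grow.
    have h1 : P.W (adviceLoad w a (i + 1) u / B u) (greedyLoad P.f B w a i u / B u) ≤ C / B u := by
      refine (P.W_advice _ _ _ hA hAA hA1 hX).trans ?_
      rw [le_div_iff₀ h0, mul_comm]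
      exact (mul_W_le_credit hw ha h0 (haB u) i hi.le).trans (credit_mono hw u hi.le)
    have h2 := P.W_lower _ _ (hA.trans hAA) hA1 hX
    have h4 : penalty P.f B w a i (greedyLoad P.f B w a i u) u
        ≤ P.f (adviceLoad w a (i + 1) u / B u) (greedyLoad P.f B w a i u / B u) + η := by
      rw [penalty, add_div]
      exact hP _ _ _ (by rw [div_le_iff₀ h0]; exact hs i u)
    have h5 : r - η ≤ C / B u + (1 - penalty P.f B w a i (greedyLoad P.f B w a i u) u) := by
      linarith
    have h6 := mul_le_mul_of_nonneg_left h5 (mul_nonneg (hw i u) (ho i u))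
    rw [greedyScore]
    linarith

end Guarantees

/-! ### Mean and variance under product distributions; capped sums -/

section ProductWeights

variable {ι α : Type*} [Fintype ι] [DecidableEq ι] [Fintype α] {p : ι → α → ℝ}

theorem sum_prod_weights (p g : ι → α → ℝ) :
    ∑ σ : ι → α, (∏ v, p v (σ v)) * ∏ v, g v (σ v) = ∏ v, ∑ x, p v x * g v x := by
  rw [Finset.prod_univ_sum, Fintype.piFinset_univ]
  exact Finset.sum_congr rfl fun σ _ => Finset.prod_mul_distrib.symm

theorem sum_weights_apply (hp : ∀ v, ∑ x, p v x = 1) (v : ι) (g : α → ℝ) :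
    ∑ σ : ι → α, (∏ i, p i (σ i)) * g (σ v) = ∑ x, p v x * g x := by
  have h := sum_prod_weights p (fun i x => if i = v then g x else 1)
  have h1 : ∀ σ : ι → α, (∏ i, if i = v then g (σ i) else 1) = g (σ v) := fun σ => by simp
  simp only [h1] at h
  rw [h, Finset.prod_eq_single v]
  · simp
  · intro i _ hi; simp [hi, hp]
  · simp

theorem sum_weights_mul_eq_zero {Y : ι → α → ℝ} (hY : ∀ v, ∑ x, p v x * Y v x = 0) {v w : ι}
    (hvw : v ≠ w) : ∑ σ : ι → α, (∏ i, p i (σ i)) * (Y v (σ v) * Y w (σ w)) = 0 := by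
  have h := sum_prod_weights p (fun i x => if i = v ∨ i = w then Y i x else 1)
  have h1 : ∀ σ : ι → α, (∏ i, if i = v ∨ i = w then Y i (σ i) else 1) = Y v (σ v) * Y w (σ w) := by
    intro σ
    rw [Finset.prod_eq_mul v w hvw]
    · simp
    · intro i _ hi; simp [hi]
    · simp
    · simp
  simp only [h1] at h
  rw [h]
  exact Finset.prod_eq_zero (Finset.mem_univ v) (by simpa using hY v)

/-- The variance of a sum of independent centered random variables. -/
theorem sum_weights_sq {Y : ι → α → ℝ} (hp : ∀ v, ∑ x, p v x = 1)
    (hY : ∀ v, ∑ x, p v x * Y v x = 0) :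
    ∑ σ : ι → α, (∏ i, p i (σ i)) * (∑ v, Y v (σ v)) ^ 2 = ∑ v, ∑ x, p v x * Y v x ^ 2 := by
  have h1 : ∀ σ : ι → α, (∏ i, p i (σ i)) * (∑ v, Y v (σ v)) ^ 2
      = ∑ v, ∑ w, (∏ i, p i (σ i)) * (Y v (σ v) * Y w (σ w)) := by
    intro σ
    rw [sq, Finset.sum_mul_sum, Finset.mul_sum]
    exact Finset.sum_congr rfl fun v _ => Finset.mul_sum ..
  simp only [h1]
  rw [Finset.sum_comm]
  refine Finset.sum_congr rfl fun v _ => ?_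
  rw [Finset.sum_comm, Finset.sum_eq_single v]
  · rw [← sum_weights_apply hp v (fun x => Y v x ^ 2)]
    exact Finset.sum_congr rfl fun σ _ => by ring
  · intro w _ hw
    exact sum_weights_mul_eq_zero hY hw.symm
  · simp

end ProductWeights

/-- With `x = S - μ` this is `x - Δ ≤ x ^ 2 / (4 * Δ)`, that is `(x - 2 * Δ) ^ 2 ≥ 0`. It bounds the
expected loss by capping in terms of the variance. -/
theorem sub_sq_div_le_min {S a μ Δ : ℝ} (hΔ : 0 < Δ) (h : μ + Δ ≤ a) :
    S - (S - μ) ^ 2 / (4 * Δ) ≤ min S a := by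
  have h0 : 0 ≤ (S - μ) ^ 2 / (4 * Δ) := by positivity
  refine le_min (by linarith) ?_
  have : S - μ - Δ ≤ (S - μ) ^ 2 / (4 * Δ) := by
    rw [le_div_iff₀ (by positivity)]
    nlinarith [sq_nonneg (S - μ - 2 * Δ)]
  linarith

/-- A sum of independent random variables that take the values `0` and `b v ≤ M`, capped at a level
above its mean, loses little in expectation. -/
theorem le_sum_weights_min {ι α : Type*} [Fintype ι] [DecidableEq ι] [Fintype α] [DecidableEq α]
    {p : ι → α → ℝ} (hp0 : ∀ v x, 0 ≤ p v x) (hp : ∀ v, ∑ x, p v x = 1) {b : ι → ℝ} {M Δ a : ℝ}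
    (hb : ∀ v, 0 ≤ b v) (hbM : ∀ v, b v ≤ M) (y : α) (hΔ : 0 < Δ)
    (ha : ∑ v, b v * p v y + Δ ≤ a) :
    (∑ v, b v * p v y) * (1 - M / (4 * Δ)) ≤
      ∑ σ : ι → α, (∏ v, p v (σ v)) * min (∑ v, if σ v = y then b v else 0) a := by
  set μ := ∑ v, b v * p v y with hμ
  have hm : ∀ v, ∑ x, p v x * (if x = y then b v else 0) = b v * p v y := fun v => by
    simp [mul_comm]
  have h1 : ∑ σ : ι → α, (∏ v, p v (σ v)) * (∑ v, if σ v = y then b v else 0) = μ := by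
    simp only [Finset.mul_sum]
    rw [Finset.sum_comm]
    refine Finset.sum_congr rfl fun v _ => ?_
    rw [sum_weights_apply hp v (fun x => if x = y then b v else 0), hm]
  let Y : ι → α → ℝ := fun v x => (if x = y then b v else 0) - b v * p v y
  have hY : ∀ v, ∑ x, p v x * Y v x = 0 := fun v => by
    simp only [Y, mul_sub, Finset.sum_sub_distrib, hm, ← Finset.sum_mul, hp]
    ring
  have h2 : ∑ σ : ι → α, (∏ v, p v (σ v)) * ((∑ v, if σ v = y then b v else 0) - μ) ^ 2
      ≤ M * μ := by
    have h3 := sum_weights_sq hp hY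
    have h4 : ∀ σ : ι → α, ∑ v, Y v (σ v) = (∑ v, if σ v = y then b v else 0) - μ := fun σ => by
      simp only [Y, Finset.sum_sub_distrib, hμ]
    simp only [h4] at h3
    rw [h3, hμ, Finset.mul_sum]
    refine Finset.sum_le_sum fun v _ => ?_
    have h5 : ∑ x, p v x * Y v x ^ 2 = b v ^ 2 * p v y - (b v * p v y) ^ 2 := by
      have : ∀ x, p v x * Y v x ^ 2 = (p v x * (if x = y then b v ^ 2 else 0))
          - 2 * (b v * p v y) * (p v x * (if x = y then b v else 0))
          + p v x * (b v * p v y) ^ 2 := fun x => by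
        simp only [Y]
        split_ifs <;> ring
      simp only [this, Finset.sum_add_distrib, Finset.sum_sub_distrib, ← Finset.mul_sum,
        ← Finset.sum_mul, hm, hp]
      simp
      ring
    rw [h5]
    have h6 := mul_le_mul_of_nonneg_right (hbM v) (mul_nonneg (hb v) (hp0 v y))
    nlinarith [sq_nonneg (b v * p v y)]
  calc μ * (1 - M / (4 * Δ)) = μ - M * μ / (4 * Δ) := by ring
    _ ≤ μ - (∑ σ : ι → α, (∏ v, p v (σ v)) * ((∑ v, if σ v = y then b v else 0) - μ) ^ 2)
        / (4 * Δ) := by gcongr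
    _ = ∑ σ : ι → α, (∏ v, p v (σ v)) * ((∑ v, if σ v = y then b v else 0)
        - ((∑ v, if σ v = y then b v else 0) - μ) ^ 2 / (4 * Δ)) := by
      simp only [mul_sub, Finset.sum_sub_distrib]
      rw [h1, Finset.sum_div]
      simp only [mul_div_assoc]
    _ ≤ _ := by
      gcongr with σ _
      · exact Finset.prod_nonneg fun v _ => hp0 v _
      · exact sub_sq_div_le_min hΔ ha

/-! ### Payments under budgets, and the loss in independent rounding -/

namespace Instance

variable {m n : ℕ} (I : Instance m n)

theorem spent_nonneg (σ : Fin n → Option (Fin m)) (u : Fin m) (t : ℕ) : 0 ≤ I.spent σ u t := by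
  induction t with
  | zero => exact le_rfl
  | succ t ih =>
    rw [spent]
    split_ifs
    · exact add_nonneg ih (I.bid_nonneg _ _)
    · simpa using ih
    · simpa using ih

theorem spent_le_budget (σ : Fin n → Option (Fin m)) (u : Fin m) (t : ℕ) :
    I.spent σ u t ≤ I.budget u := by
  induction t with
  | zero => exact I.budget_nonneg u
  | succ t ih =>
    rw [spent]
    split_ifs with h1 h2
    · linarith [h2.2]
    · simpa using ih
    · simpa using ih

/-- Unless an advertiser has nearly exhausted its budget, it pays for all its impressions. -/
theorem min_le_spent {ε : ℝ} (hI : I.SmallBids ε) (σ : Fin n → Option (Fin m)) (u : Fin m) :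
    min (∑ v, if σ v = some u then I.bid u v else 0) ((1 - ε) * I.budget u) ≤ I.spent σ u n := by
  have key : ∀ t, min (∑ i ∈ Finset.range t, if h : i < n then
      if σ ⟨i, h⟩ = some u then I.bid u ⟨i, h⟩ else 0 else 0) ((1 - ε) * I.budget u)
      ≤ I.spent σ u t := by
    intro t
    induction t with
    | zero => exact min_le_left _ _
    | succ t ih =>
      rw [spent, Finset.sum_range_succ]
      by_cases h : t < n
      · rw [dif_pos h, dif_pos h]
        have hb := I.bid_nonneg u ⟨t, h⟩
        by_cases h1 : σ ⟨t, h⟩ = some u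
        · rw [if_pos h1]
          split_ifs with h2
          · rcases min_le_iff.1 ih with h3 | h3
            · exact min_le_of_left_le (by linarith)
            · exact min_le_of_right_le (by linarith)
          -- A refused bid, at most `ε` times the budget, exceeds what remains, so `1 - ε` of the
          -- budget is spent.
          · rw [not_and] at h2
            have h2 := not_le.1 (h2 h1)
            have := hI u ⟨t, h⟩
            exact min_le_of_right_le (by linarith)
        · rw [if_neg h1, if_neg (fun h2 => h1 h2.1)]
          simpa using ih
      · rw [dif_neg h, dif_neg h]
        simpa using ih
  have := key n
  rw [Finset.sum_range] at this
  simpa using this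

open Classical in
/-- An assignment yields a fractional assignment that respects the budgets: that of the impressions
which are paid for. -/
def paid (σ : Fin n → Option (Fin m)) (v : Fin n) (u : Fin m) : ℝ :=
  if σ v = some u ∧ I.bid u v ≤ I.budget u - I.spent σ u v then 1 else 0

theorem paid_nonneg (σ : Fin n → Option (Fin m)) (v : Fin n) (u : Fin m) : 0 ≤ I.paid σ v u := by
  unfold paid; split_ifs <;> norm_num

theorem sum_paid_le_one (σ : Fin n → Option (Fin m)) (v : Fin n) : ∑ u, I.paid σ v u ≤ 1 := by
  calc ∑ u, I.paid σ v u ≤ ∑ u, if σ v = some u then (1 : ℝ) else 0 := by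
        gcongr with u
        unfold paid
        split_ifs with h1 h2 h2
        · exact le_rfl
        · exact absurd h1.1 h2
        · norm_num
        · exact le_rfl
    _ ≤ 1 := by rcases σ v with _ | u <;> simp

theorem spent_eq_sum_paid (σ : Fin n → Option (Fin m)) (u : Fin m) :
    I.spent σ u n = ∑ v, I.bid u v * I.paid σ v u := by
  have key : ∀ t, I.spent σ u t = ∑ i ∈ Finset.range t, if h : i < n then
      I.bid u ⟨i, h⟩ * I.paid σ ⟨i, h⟩ u else 0 := by
    intro t
    induction t with
    | zero => rfl
    | succ t ih =>
      rw [spent, Finset.sum_range_succ, ← ih]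
      congr 1
      split_ifs with h h1
      · rw [paid, if_pos h1, mul_one]
      · rw [paid, if_neg h1, mul_zero]
      · rfl
  rw [key n, Finset.sum_range]
  simp

end Instance

/-- Independent rounding of a fractional assignment `x` that nearly respects the budgets, with
probabilities `(1 - e) x`, where `e` is the square root of the bid-to-budget ratio. -/
theorem rounding_lower_bound {m n : ℕ} (I : Instance m n) {e : ℝ} (he : 0 < e) (he4 : e ≤ 1 / 4)
    (hI : I.SmallBids (e ^ 2)) {p : Fin n → Option (Fin m) → ℝ} (hp0 : ∀ v x, 0 ≤ p v x)
    (hp : ∀ v, ∑ x, p v x = 1) {x : Fin n → Fin m → ℝ} (hx : ∀ v u, 0 ≤ x v u)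
    (hpx : ∀ v u, p v (some u) = (1 - e) * x v u)
    (hxB : ∀ u, ∑ v, I.bid u v * x v u ≤ (1 + e ^ 2) * I.budget u) :
    (1 - 2 * e) * ∑ u, ∑ v, I.bid u v * x v u ≤
      ∑ σ : Fin n → Option (Fin m), (∏ v, p v (σ v)) * I.revenue σ := by
  unfold Instance.revenue
  simp only [Finset.mul_sum]
  rw [Finset.sum_comm (s := (Finset.univ : Finset (Fin n → Option (Fin m))))]
  refine Finset.sum_le_sum fun u _ => ?_
  rw [← Finset.mul_sum]
  set F := ∑ v, I.bid u v * x v u with hF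
  have hF0 : 0 ≤ F := Finset.sum_nonneg fun v _ => mul_nonneg (I.bid_nonneg u v) (hx v u)
  have hspent : 0 ≤ ∑ σ : Fin n → Option (Fin m), (∏ v, p v (σ v)) * I.spent σ u n :=
    Finset.sum_nonneg fun σ _ => mul_nonneg (Finset.prod_nonneg fun v _ => hp0 v _)
      (I.spent_nonneg σ u n)
  rcases (I.budget_nonneg u).eq_or_lt with hB | hB
  · have : F = 0 := le_antisymm (by simpa [← hB] using hxB u) hF0
    rw [this, mul_zero]
    exact hspent
  · have hμ : ∑ v, I.bid u v * p v (some u) = (1 - e) * F := by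
      rw [hF, Finset.mul_sum]
      exact Finset.sum_congr rfl fun v _ => by rw [hpx]; ring
    -- The relative slack is `(1 - e ^ 2) - (1 - e) * (1 + e ^ 2) = e * (1 - e) ^ 2`, at least `e /
    -- 2` for `e ≤ 1 / 4`.
    have ha : ∑ v, I.bid u v * p v (some u) + I.budget u * e / 2 ≤ (1 - e ^ 2) * I.budget u := by
      have h1 : (1 - e) * F ≤ (1 - e) * ((1 + e ^ 2) * I.budget u) :=
        mul_le_mul_of_nonneg_left (hxB u) (by linarith)
      have h2 : 0 ≤ e * I.budget u * (1 / 2 - 2 * e + e ^ 2) :=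
        mul_nonneg (by positivity) (by nlinarith)
      rw [hμ]
      nlinarith
    have h := le_sum_weights_min hp0 hp (I.bid_nonneg u) (hI u) (some u) (by positivity) ha
    have h3 : e ^ 2 * I.budget u / (4 * (I.budget u * e / 2)) = e / 2 := by field_simp; ring
    rw [hμ, h3] at h
    have h4 : (1 - 2 * e) * F ≤ (1 - e) * F * (1 - e / 2) := by nlinarith [sq_nonneg e]
    refine h4.trans (h.trans ?_)
    gcongr with σ _
    · exact Finset.prod_nonneg fun v _ => hp0 v _
    · exact I.min_le_spent hI σ u

/-! ### An exchange inequality for the potential `V` -/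

/-- If `f` grows along diagonals, then going up first and right afterwards is the worst way to get
from `(0, X)` to `(A, X + h)`. -/
theorem integral_exchange_le {f : ℝ → ℝ → ℝ} (hmono : ∀ A, Monotone (f A))
    (hanti : ∀ X, Antitone fun A => f A X) (hdiag : ∀ A X t, 0 ≤ t → f A X ≤ f (A + t) (X + t))
    {A h : ℝ} (X : ℝ) (hA : 0 ≤ A) (hh : 0 ≤ h) :
    (∫ x in X..X + h, f 0 x) + ∫ a in (0 : ℝ)..A, f a X ≤
      (∫ a in (0 : ℝ)..A, f a (X + h)) + h * f A (X + h) := by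
  -- At unit speed, `L` follows the path `(0, X + h)`, `(0, X)`, `(A, X)`; `R` goes from `(0, X +
  -- h)` to `(A, X + h)` and stays there for time `h`. The integrands compare pointwise.
  let L : ℝ → ℝ := fun t => f (max (t - h) 0) (X + max (h - t) 0)
  let R : ℝ → ℝ := fun t => f (min t A) (X + h)
  have hL : Antitone L := fun s t hst =>
    (hanti _ (max_le_max (by linarith) le_rfl)).trans
      (hmono _ (add_le_add_right (max_le_max (by linarith) le_rfl) _))
  have hR : Antitone R := fun s t hst => hanti _ (min_le_min hst le_rfl)
  have hLi : ∀ a b, IntervalIntegrable L MeasureTheory.volume a b := fun a b => hL.intervalIntegrable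
  have hRi : ∀ a b, IntervalIntegrable R MeasureTheory.volume a b := fun a b => hR.intervalIntegrable
  have key : ∫ t in (0 : ℝ)..A + h, L t ≤ ∫ t in (0 : ℝ)..A + h, R t := by
    refine intervalIntegral.integral_mono_on (by linarith) (hLi _ _) (hRi _ _) fun t ht => ?_
    have ht0 := ht.1
    have ht1 := ht.2
    have h1 : max (t - h) 0 ≤ min t A :=
      max_le (le_min (by linarith) (by linarith)) (le_min ht0 hA)
    -- The diagonal from the point of `L` to the abscissa of `R` ends no higher than `X + h`.
    have h2 := hdiag (max (t - h) 0) (X + max (h - t) 0) (min t A - max (t - h) 0) (by linarith)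
    rw [add_sub_cancel] at h2
    refine h2.trans (hmono _ ?_)
    rcases le_total t h with h3 | h3
    · rw [max_eq_right (by linarith : t - h ≤ 0), max_eq_left (by linarith : 0 ≤ h - t)]
      have := min_le_left t A
      linarith
    · rw [max_eq_left (by linarith : 0 ≤ t - h), max_eq_right (by linarith : h - t ≤ 0)]
      have := min_le_left t A
      linarith
  rw [← intervalIntegral.integral_add_adjacent_intervals (hLi 0 h) (hLi h (A + h)),
    ← intervalIntegral.integral_add_adjacent_intervals (hRi 0 A) (hRi A (A + h))] at key
  have e1 : ∫ t in (0 : ℝ)..h, L t = ∫ x in X..X + h, f 0 x := by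
    rw [intervalIntegral.integral_congr (g := fun t => f 0 (X + h - t))]
    · rw [intervalIntegral.integral_comp_sub_left (fun x => f 0 x)]
      simp
    · intro t ht
      rw [Set.uIcc_of_le hh] at ht
      simp only [L]
      rw [max_eq_right (by linarith [ht.2] : t - h ≤ 0), max_eq_left (by linarith [ht.2])]
      congr 1; ring
  have e2 : ∫ t in h..A + h, L t = ∫ a in (0 : ℝ)..A, f a X := by
    rw [intervalIntegral.integral_congr (g := fun t => f (t - h) X)]
    · rw [intervalIntegral.integral_comp_sub_right (fun x => f x X)]
      simp
    · intro t ht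
      rw [Set.uIcc_of_le (by linarith)] at ht
      simp only [L]
      rw [max_eq_left (by linarith [ht.1] : 0 ≤ t - h),
        max_eq_right (by linarith [ht.1] : h - t ≤ 0), add_zero]
  have e3 : ∫ t in (0 : ℝ)..A, R t = ∫ a in (0 : ℝ)..A, f a (X + h) := by
    refine intervalIntegral.integral_congr fun t ht => ?_
    rw [Set.uIcc_of_le hA] at ht
    simp only [R]
    rw [min_eq_left ht.2]
  have e4 : ∫ t in A..A + h, R t = h * f A (X + h) := by
    rw [intervalIntegral.integral_congr (g := fun _ => f A (X + h))]
    · simp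
    · intro t ht
      rw [Set.uIcc_of_le (by linarith)] at ht
      simp only [R]
      rw [min_eq_right ht.1]
  rw [e1, e2, e3, e4] at key
  exact key

/-! ### The advice-free penalty, described through its inverse -/

section Penalty

variable (l : ℝ)

/-- The derivative of `levelInv`. -/
def levelSlope (t : ℝ) : ℝ := max (Real.exp (l - 1) - l) (t - l) / t ^ 2

/-- The load at which the advice-free part of the penalty reaches the level `y`. -/
def levelInv (y : ℝ) : ℝ := ∫ t in (Real.exp (l - 1) - l)..y, levelSlope l t

/-- The integral of the advice-free part of the penalty until it reaches the level `y`. -/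
def levelCredit (y : ℝ) : ℝ := ∫ t in (Real.exp (l - 1) - l)..y, t * levelSlope l t

variable {l}

theorem exp_sub_pos (hl : l < 1) : 0 < Real.exp (l - 1) - l := by
  have := Real.add_one_lt_exp (x := l - 1) (by linarith)
  linarith

theorem exp_sub_le (hl0 : 0 ≤ l) : Real.exp (l - 1) - l ≤ Real.exp (l - 1) := by linarith

theorem exp_le_one_of_lt (hl : l < 1) : Real.exp (l - 1) ≤ 1 := by
  rw [Real.exp_le_one_iff]; linarith

theorem levelSlope_pos (hl : l < 1) {t : ℝ} (ht : 0 < t) : 0 < levelSlope l t :=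
  div_pos (lt_max_of_lt_left (exp_sub_pos hl)) (by positivity)

theorem intervalIntegrable_levelSlope {a b : ℝ} (ha : 0 < a) (hb : 0 < b) :
    IntervalIntegrable (levelSlope l) MeasureTheory.volume a b := by
  refine ContinuousOn.intervalIntegrable fun t ht => ContinuousAt.continuousWithinAt ?_
  have : 0 < t := (lt_min ha hb).trans_le ht.1
  unfold levelSlope
  exact ContinuousAt.div (by fun_prop) (by fun_prop) (by positivity)

theorem intervalIntegrable_mul_levelSlope {a b : ℝ} (ha : 0 < a) (hb : 0 < b) :
    IntervalIntegrable (fun t => t * levelSlope l t) MeasureTheory.volume a b :=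
  (intervalIntegrable_levelSlope ha hb).continuousOn_mul continuousOn_id

theorem levelInv_sub (hl : l < 1) {x y : ℝ} (hx : 0 < x) (hy : 0 < y) :
    levelInv l y - levelInv l x = ∫ t in x..y, levelSlope l t := by
  unfold levelInv
  rw [intervalIntegral.integral_interval_sub_left] <;>
  exact intervalIntegrable_levelSlope (exp_sub_pos hl) (by assumption)

theorem levelCredit_sub (hl : l < 1) {x y : ℝ} (hx : 0 < x) (hy : 0 < y) :
    levelCredit l y - levelCredit l x = ∫ t in x..y, t * levelSlope l t := by
  unfold levelCredit
  rw [intervalIntegral.integral_interval_sub_left] <;>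
  exact intervalIntegrable_mul_levelSlope (exp_sub_pos hl) (by assumption)

theorem levelInv_strictMonoOn (hl : l < 1) : StrictMonoOn (levelInv l) (Set.Ioi 0) := by
  intro x hx y hy hxy
  rw [← sub_pos, levelInv_sub hl hx hy]
  exact intervalIntegral.intervalIntegral_pos_of_pos_on (intervalIntegrable_levelSlope hx hy)
    (fun t ht => levelSlope_pos hl (lt_trans hx ht.1)) hxy

theorem levelCredit_sub_le (hl : l < 1) {x y : ℝ} (hx : 0 < x) (hxy : x ≤ y) :
    levelCredit l y - levelCredit l x ≤ y * (levelInv l y - levelInv l x) := by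
  have hy := hx.trans_le hxy
  rw [levelInv_sub hl hx hy, levelCredit_sub hl hx hy, ← intervalIntegral.integral_const_mul]
  refine intervalIntegral.integral_mono_on hxy (intervalIntegrable_mul_levelSlope hx hy)
    ((intervalIntegrable_levelSlope hx hy).const_mul y) fun t ht => ?_
  exact mul_le_mul_of_nonneg_right ht.2 (levelSlope_pos hl (hx.trans_le ht.1)).le

theorem levelSlope_of_le {t : ℝ} (ht : t ≤ Real.exp (l - 1)) :
    levelSlope l t = (Real.exp (l - 1) - l) / t ^ 2 := by
  rw [levelSlope, max_eq_left (by linarith)]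

theorem levelSlope_of_ge {t : ℝ} (ht : Real.exp (l - 1) ≤ t) :
    levelSlope l t = (t - l) / t ^ 2 := by
  rw [levelSlope, max_eq_right (by linarith)]

theorem levelInv_start : levelInv l (Real.exp (l - 1) - l) = 0 :=
  intervalIntegral.integral_same

theorem levelCredit_start : levelCredit l (Real.exp (l - 1) - l) = 0 :=
  intervalIntegral.integral_same

/-- In this range load `X` and level `y` are related by `(1 - X) * y = exp (l - 1) - l`. -/
theorem levelInv_of_le (hl : l < 1) {y : ℝ} (hky : Real.exp (l - 1) - l ≤ y)
    (hy : y ≤ Real.exp (l - 1)) : levelInv l y = 1 - (Real.exp (l - 1) - l) / y := by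
  have hk := exp_sub_pos hl
  set k := Real.exp (l - 1) - l with hkdef
  unfold levelInv
  rw [← hkdef, intervalIntegral.integral_eq_sub_of_hasDerivAt (f := fun t => -k * t⁻¹)]
  · field_simp; ring
  · intro t ht
    rw [Set.uIcc_of_le hky] at ht
    have ht0 : t ≠ 0 := (hk.trans_le ht.1).ne'
    rw [levelSlope_of_le (ht.2.trans hy)]
    exact ((hasDerivAt_inv ht0).const_mul (-k)).congr_deriv (by rw [← hkdef]; field_simp)
  · exact intervalIntegrable_levelSlope hk (hk.trans_le hky)

/-- The summand `log y + 1 - l` is the excess at which the exponential penalty equals `y`; the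
remaining load is `l / y`. -/
theorem levelInv_of_ge (hl0 : 0 ≤ l) (hl : l < 1) {y : ℝ} (hy : Real.exp (l - 1) ≤ y) :
    levelInv l y = Real.log y + 1 - l + l / y := by
  have hp := Real.exp_pos (l - 1)
  have h1 := levelInv_sub hl hp (hp.trans_le hy)
  rw [levelInv_of_le hl (exp_sub_le hl0) le_rfl,
    intervalIntegral.integral_eq_sub_of_hasDerivAt (f := fun t => Real.log t + l * t⁻¹),
    Real.log_exp] at h1
  · have : (Real.exp (l - 1) - l) / Real.exp (l - 1) = 1 - l / Real.exp (l - 1) := by field_simp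
    rw [this, ← div_eq_mul_inv, ← div_eq_mul_inv] at h1
    linarith
  · intro t ht
    rw [Set.uIcc_of_le hy] at ht
    have ht0 : t ≠ 0 := (hp.trans_le ht.1).ne'
    rw [levelSlope_of_ge ht.1]
    exact ((Real.hasDerivAt_log ht0).fun_add ((hasDerivAt_inv ht0).const_mul l)).congr_deriv
      (by field_simp; ring)
  · exact intervalIntegrable_levelSlope hp (hp.trans_le hy)

theorem levelInv_one (hl0 : 0 ≤ l) (hl : l < 1) : levelInv l 1 = 1 := by
  rw [levelInv_of_ge hl0 hl (exp_le_one_of_lt hl)]; simp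

theorem levelCredit_one (hl0 : 0 ≤ l) (hl : l < 1) : levelCredit l 1 = robustness l := by
  have hk := exp_sub_pos hl
  have hp := Real.exp_pos (l - 1)
  have h1 : levelCredit l (Real.exp (l - 1)) = (Real.exp (l - 1) - l)
      * (l - 1 - Real.log (Real.exp (l - 1) - l)) := by
    set k := Real.exp (l - 1) - l with hkdef
    unfold levelCredit
    rw [← hkdef, intervalIntegral.integral_eq_sub_of_hasDerivAt (f := fun t => k * Real.log t)]
    · rw [Real.log_exp]; ring
    · intro t ht
      rw [Set.uIcc_of_le (by linarith)] at ht
      have ht0 : t ≠ 0 := (hk.trans_le ht.1).ne'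
      rw [levelSlope_of_le ht.2]
      exact ((Real.hasDerivAt_log ht0).const_mul k).congr_deriv (by rw [← hkdef]; field_simp)
    · exact intervalIntegrable_mul_levelSlope hk hp
  have h2 := levelCredit_sub hl hp one_pos
  rw [intervalIntegral.integral_eq_sub_of_hasDerivAt (f := fun t => t - l * Real.log t),
    Real.log_exp, Real.log_one] at h2
  · have h3 : Real.log (1 - l * Real.exp (1 - l)) = Real.log (Real.exp (l - 1) - l) - (l - 1) := by
      have h4 : 1 - l * Real.exp (1 - l) = (Real.exp (l - 1) - l) / Real.exp (l - 1) := by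
        rw [← neg_sub l 1, Real.exp_neg]; field_simp
      rw [h4, Real.log_div hk.ne' hp.ne', Real.log_exp]
    rw [robustness, h3]
    rw [h1] at h2
    linarith
  · intro t ht
    rw [Set.uIcc_of_le (exp_le_one_of_lt hl)] at ht
    have ht0 : t ≠ 0 := (hp.trans_le ht.1).ne'
    rw [levelSlope_of_ge ht.1]
    exact ((hasDerivAt_id' t).fun_sub ((Real.hasDerivAt_log ht0).const_mul l)).congr_deriv
      (by field_simp)
  · exact intervalIntegrable_mul_levelSlope hp one_pos

/-- The integrand of `levelCredit` is `max (exp (l - 1) - l) (t - l) / t ≤ 1`, so `levelCredit l y -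
y` decreases and is smallest at `y = 1`. -/
theorem robustness_le_levelCredit (hl0 : 0 ≤ l) (hl : l < 1) {y : ℝ}
    (hky : Real.exp (l - 1) - l ≤ y) (hy : y ≤ 1) : robustness l ≤ levelCredit l y + 1 - y := by
  have hy0 := (exp_sub_pos hl).trans_le hky
  have h1 := levelCredit_sub hl hy0 one_pos
  have h2 : ∫ t in y..1, t * levelSlope l t ≤ ∫ _ in y..1, (1 : ℝ) := by
    refine intervalIntegral.integral_mono_on hy (intervalIntegrable_mul_levelSlope hy0 one_pos)
      (by simp) fun t ht => ?_
    have ht0 := hy0.trans_le ht.1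
    have h3 : max (Real.exp (l - 1) - l) (t - l) ≤ t := max_le (hky.trans ht.1) (by linarith)
    calc t * levelSlope l t = max (Real.exp (l - 1) - l) (t - l) / t := by
          unfold levelSlope; field_simp
      _ ≤ 1 := (div_le_one ht0).2 h3
  rw [intervalIntegral.integral_const, smul_eq_mul, mul_one, ← h1, levelCredit_one hl0 hl] at h2
  linarith

theorem two_mul_log_le {t : ℝ} (ht : 1 ≤ t) : 2 * Real.log t ≤ t - t⁻¹ := by
  have h := Real.self_le_sinh_iff.2 (Real.log_nonneg ht)
  rw [Real.sinh_log (by linarith)] at h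
  linarith

/-- With `y = 1 - l * exp (1 - l)`, the claim is `-exp (l - 1) * y * log y ≤ l * (1 - l)`. Bounding
`-log y` by `1 / √y - √y` turns the left side into `l * √y`, and `exp (1 - l) ≥ 2 - l` gives `√y ≤ 1
- l`. -/
theorem robustness_le_one_sub_exp (hl0 : 0 ≤ l) (hl : l < 1) :
    robustness l ≤ 1 - Real.exp (l - 1) := by
  have hk := exp_sub_pos hl
  have hp := Real.exp_pos (l - 1)
  set y := 1 - l * Real.exp (1 - l) with hy
  have hky : Real.exp (l - 1) - l = Real.exp (l - 1) * y := by
    rw [hy, ← neg_sub l 1, Real.exp_neg]; field_simp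
  have hy0 : 0 < y := by
    rw [hky] at hk; exact pos_of_mul_pos_right hk hp.le
  have hy1 : y ≤ (1 - l) ^ 2 := by
    have := Real.add_one_le_exp (1 - l)
    nlinarith
  have hs0 : 0 < √y := Real.sqrt_pos.2 hy0
  have hs1 : √y ≤ 1 - l := Real.sqrt_le_iff.2 ⟨by linarith, hy1⟩
  have hlog : -Real.log y ≤ (√y)⁻¹ - √y := by
    have h := two_mul_log_le ((one_le_inv₀ hs0).2 (by linarith))
    rw [Real.log_inv, Real.log_sqrt hy0.le, inv_inv] at h
    linarith
  have h1 : -((Real.exp (l - 1) - l) * Real.log y) ≤ l * √y := by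
    have h2 := mul_le_mul_of_nonneg_left hlog hk.le
    have hsq := Real.sq_sqrt hy0.le
    have h3 : (Real.exp (l - 1) - l) * ((√y)⁻¹ - √y) = l * √y := by
      have h4 : l = Real.exp (l - 1) * (1 - √y ^ 2) := by rw [hsq]; linarith
      calc _ = Real.exp (l - 1) * √y ^ 2 * ((√y)⁻¹ - √y) := by rw [hky, hsq]
        _ = Real.exp (l - 1) * (1 - √y ^ 2) * √y := by field_simp
        _ = l * √y := by rw [← h4]
    linarith
  have h5 := mul_le_mul_of_nonneg_left hs1 hl0
  rw [robustness, ← hy]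
  linarith

end Penalty

/-! ### The tradeoff penalty and its potentials -/

section Tradeoff

variable (l : ℝ)

/-- The exponential penalty of the advice-free algorithm, reaching 1 at load `1 - l`. -/
def expPenalty (z : ℝ) : ℝ := min 1 (Real.exp (z + l - 1))

/-- The penalty for exceeding the load of the advice by `z`. -/
def excessPenalty (z : ℝ) : ℝ := if z ≤ 0 then 0 else expPenalty l z

open Classical in
/-- The penalty for the load `X` regardless of the advice, which is inverse to `levelInv`. -/
def loadPenalty (X : ℝ) : ℝ :=
  if h : ∃ y ∈ Set.Icc (Real.exp (l - 1) - l) 1, levelInv l y = max 0 (min 1 X)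
  then h.choose else 0

/-- The penalty for the load `X` when the load of the advice is `A`. -/
def tradeoffPenalty (A X : ℝ) : ℝ := max (excessPenalty l (X - A)) (loadPenalty l X)

variable {l}

theorem expPenalty_nonneg (z : ℝ) : 0 ≤ expPenalty l z := le_min zero_le_one (Real.exp_nonneg _)

theorem expPenalty_le_one (z : ℝ) : expPenalty l z ≤ 1 := min_le_left _ _

theorem expPenalty_mono : Monotone (expPenalty l) := fun x y h =>
  min_le_min le_rfl (Real.exp_le_exp.2 (by linarith))

theorem expPenalty_zero (hl : l < 1) : expPenalty l 0 = Real.exp (l - 1) := by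
  rw [expPenalty, zero_add, min_eq_right (exp_le_one_of_lt hl)]

/-- The exponential is its own derivative and increasing; truncation at 1 preserves the bound. -/
theorem expPenalty_add_sub_le (z : ℝ) {h : ℝ} (hh : 0 ≤ h) :
    expPenalty l (z + h) - expPenalty l z ≤ h * expPenalty l (z + h) := by
  set E := Real.exp (z + h + l - 1) with hE
  have h1 : Real.exp (z + l - 1) = E * Real.exp (-h) := by rw [hE, ← Real.exp_add]; congr 1; ring
  have h2 : 1 - h ≤ Real.exp (-h) := by linarith [Real.add_one_le_exp (-h)]
  have h3 : E * (1 - h) ≤ Real.exp (z + l - 1) := by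
    rw [h1]; exact mul_le_mul_of_nonneg_left h2 (Real.exp_nonneg _)
  unfold expPenalty
  rw [← hE]
  have h5 : Real.exp (-h) ≤ 1 := Real.exp_le_one_iff.2 (by linarith)
  rcases le_total 1 E with h4 | h4
  · rw [min_eq_left h4]
    have : 1 - h ≤ min 1 (Real.exp (z + l - 1)) := by
      refine le_min (by linarith) (h2.trans ?_)
      rw [h1]
      exact le_mul_of_one_le_left (Real.exp_nonneg _) h4
    linarith
  · rw [min_eq_right h4]
    have : E * (1 - h) ≤ min 1 (Real.exp (z + l - 1)) := by
      refine le_min ?_ h3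
      nlinarith [Real.exp_nonneg (z + h + l - 1)]
    linarith

theorem excessPenalty_nonneg (z : ℝ) : 0 ≤ excessPenalty l z := by
  unfold excessPenalty; split_ifs
  exacts [le_rfl, expPenalty_nonneg z]

theorem excessPenalty_le_one (z : ℝ) : excessPenalty l z ≤ 1 := by
  unfold excessPenalty; split_ifs
  exacts [zero_le_one, expPenalty_le_one z]

theorem excessPenalty_of_pos {z : ℝ} (hz : 0 < z) : excessPenalty l z = expPenalty l z :=
  if_neg hz.not_ge

theorem excessPenalty_mono : Monotone (excessPenalty l) := by
  intro x y h
  rcases le_or_gt x 0 with hx | hx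
  · rw [excessPenalty, if_pos hx]; exact excessPenalty_nonneg y
  · rw [excessPenalty_of_pos hx, excessPenalty_of_pos (hx.trans_le h)]
    exact expPenalty_mono h

/-- By the intermediate value theorem every clipped load is attained, so the default value 0 is
never taken. -/
theorem loadPenalty_spec (hl0 : 0 ≤ l) (hl : l < 1) (X : ℝ) :
    loadPenalty l X ∈ Set.Icc (Real.exp (l - 1) - l) 1 ∧
    levelInv l (loadPenalty l X) = max 0 (min 1 X) := by
  have hk := exp_sub_pos hl
  have hk1 : Real.exp (l - 1) - l ≤ 1 := (exp_sub_le hl0).trans (exp_le_one_of_lt hl)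
  have hc : ContinuousOn (levelInv l) (Set.Icc (Real.exp (l - 1) - l) 1) := by
    have := intervalIntegral.continuousOn_primitive_interval'
      (intervalIntegrable_levelSlope (l := l) hk one_pos) Set.left_mem_uIcc
    rwa [Set.uIcc_of_le hk1] at this
  have h : ∃ y ∈ Set.Icc (Real.exp (l - 1) - l) 1, levelInv l y = max 0 (min 1 X) := by
    have := intermediate_value_Icc hk1 hc
    rw [levelInv_start, levelInv_one hl0 hl] at this
    exact this ⟨le_max_left _ _, max_le zero_le_one (min_le_left _ _)⟩
  unfold loadPenalty
  rw [dif_pos h]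
  exact h.choose_spec

theorem loadPenalty_pos (hl0 : 0 ≤ l) (hl : l < 1) (X : ℝ) : 0 < loadPenalty l X :=
  (exp_sub_pos hl).trans_le (loadPenalty_spec hl0 hl X).1.1

theorem loadPenalty_mono (hl0 : 0 ≤ l) (hl : l < 1) : Monotone (loadPenalty l) := by
  intro X Y h
  by_contra! h1
  have h2 := levelInv_strictMonoOn hl (loadPenalty_pos hl0 hl Y) (loadPenalty_pos hl0 hl X) h1
  rw [(loadPenalty_spec hl0 hl X).2, (loadPenalty_spec hl0 hl Y).2] at h2
  exact h2.not_ge (max_le_max le_rfl (min_le_min le_rfl h))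

theorem loadPenalty_of_one_le (hl0 : 0 ≤ l) (hl : l < 1) {X : ℝ} (hX : 1 ≤ X) :
    loadPenalty l X = 1 := by
  refine (levelInv_strictMonoOn hl).injOn (loadPenalty_pos hl0 hl X) (Set.mem_Ioi.2 one_pos) ?_
  rw [(loadPenalty_spec hl0 hl X).2, levelInv_one hl0 hl, min_eq_left hX, max_eq_right zero_le_one]

theorem loadPenalty_zero (hl0 : 0 ≤ l) (hl : l < 1) : loadPenalty l 0 = Real.exp (l - 1) - l := by
  refine (levelInv_strictMonoOn hl).injOn (loadPenalty_pos hl0 hl 0) (exp_sub_pos hl) ?_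
  rw [(loadPenalty_spec hl0 hl 0).2, levelInv_start, min_eq_right zero_le_one, max_self]

theorem tradeoffPenalty_mono (hl0 : 0 ≤ l) (hl : l < 1) (A : ℝ) :
    Monotone (tradeoffPenalty l A) := fun X Y h =>
  max_le_max (excessPenalty_mono (by linarith)) (loadPenalty_mono hl0 hl h)

theorem tradeoffPenalty_diag (hl0 : 0 ≤ l) (hl : l < 1) (A X t : ℝ) (ht : 0 ≤ t) :
    tradeoffPenalty l A X ≤ tradeoffPenalty l (A + t) (X + t) :=
  max_le_max (by rw [add_sub_add_right_eq_sub]) (loadPenalty_mono hl0 hl (by linarith))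

theorem tradeoffPenalty_anti (X : ℝ) : Antitone fun A => tradeoffPenalty l A X := fun A A' h =>
  max_le_max (excessPenalty_mono (by linarith)) le_rfl

theorem tradeoffPenalty_le_one (hl0 : 0 ≤ l) (hl : l < 1) (A X : ℝ) : tradeoffPenalty l A X ≤ 1 :=
  max_le (excessPenalty_le_one _) (loadPenalty_spec hl0 hl X).1.2

theorem le_tradeoffPenalty (hl0 : 0 ≤ l) (hl : l < 1) (A X : ℝ) :
    Real.exp (l - 1) - l ≤ tradeoffPenalty l A X :=
  (loadPenalty_spec hl0 hl X).1.1.trans (le_max_right _ _)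

theorem exp_sub_exp_le_integral_excessPenalty {ξ : ℝ} (h0 : 0 ≤ ξ) (h1 : ξ ≤ 1 - l) :
    Real.exp (ξ + l - 1) - Real.exp (l - 1) ≤ ∫ z in (0 : ℝ)..ξ, excessPenalty l z := by
  have h2 : ∫ z in (0 : ℝ)..ξ, Real.exp (z + l - 1)
      = Real.exp (ξ + l - 1) - Real.exp (0 + l - 1) := by
    refine intervalIntegral.integral_eq_sub_of_hasDerivAt (f := fun z => Real.exp (z + l - 1))
      (fun z _ => ?_) (Continuous.intervalIntegrable (by fun_prop) _ _)
    exact ((((hasDerivAt_id' z).add_const l).sub_const 1).exp).congr_deriv (by simp)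
  rw [zero_add] at h2
  rw [← h2]
  refine intervalIntegral.integral_mono_on_of_le_Ioo h0
    (Continuous.intervalIntegrable (by fun_prop) _ _) excessPenalty_mono.intervalIntegrable
    fun z hz => ?_
  rw [excessPenalty_of_pos hz.1, expPenalty, min_eq_right]
  rw [Real.exp_le_one_iff]
  linarith [hz.2]

/-- The excess `ξ` over the advice from which on the excess determines the penalty for the
load `X`. -/
theorem exists_threshold (hl0 : 0 ≤ l) (hl : l < 1) {X : ℝ} (hX : 0 ≤ X) (hX1 : X ≤ 1) :
    ∃ ξ, 0 ≤ ξ ∧ ξ ≤ 1 - l ∧ ξ ≤ X ∧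
    X - ξ ≤ 1 ∧ (∀ z, ξ < z → loadPenalty l X ≤ excessPenalty l z) ∧
    (∀ z ≤ ξ, excessPenalty l z ≤ loadPenalty l X) ∧
    (1 - (X - ξ)) * loadPenalty l X ≤ Real.exp (ξ + l - 1) - l := by
  obtain ⟨⟨hk, h1⟩, hinv⟩ := loadPenalty_spec hl0 hl X
  have hy0 := loadPenalty_pos hl0 hl X
  set y := loadPenalty l X
  rw [min_eq_right hX1, max_eq_right hX] at hinv
  rcases le_total y (Real.exp (l - 1)) with hy | hy
  -- Below the height `exp (l - 1)` of the jump, any positive excess already dominates; the last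
  -- inequality is an equality in both cases.
  · refine ⟨0, le_rfl, by linarith, hX, by linarith, fun z hz => ?_, fun z hz => ?_, ?_⟩
    · rw [excessPenalty_of_pos hz]
      refine hy.trans ?_
      rw [← expPenalty_zero hl]
      exact expPenalty_mono hz.le
    · rw [excessPenalty, if_pos hz]; exact hy0.le
    · rw [levelInv_of_le hl hk hy] at hinv
      rw [← hinv, sub_zero, sub_sub_cancel, div_mul_cancel₀ _ hy0.ne', zero_add]
  · rw [levelInv_of_ge hl0 hl hy] at hinv
    have hlog : l - 1 ≤ Real.log y := (Real.le_log_iff_exp_le hy0).2 hy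
    have hlog1 : Real.log y ≤ 0 := Real.log_nonpos hy0.le h1
    have hly : l / y ≤ 1 := by
      rw [div_le_one hy0]
      exact le_trans (by linarith [Real.add_one_le_exp (l - 1)]) hy
    have hly0 : 0 ≤ l / y := div_nonneg hl0 hy0.le
    have hexp : Real.exp (Real.log y + 1 - l + l - 1) = y := by
      rw [show Real.log y + 1 - l + l - 1 = Real.log y by ring, Real.exp_log hy0]
    have hpen : expPenalty l (Real.log y + 1 - l) = y := by
      rw [expPenalty, hexp, min_eq_right h1]
    refine ⟨Real.log y + 1 - l, by linarith, by linarith, by linarith, by linarith,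
      fun z hz => ?_, fun z hz => ?_, ?_⟩
    · rw [excessPenalty_of_pos (by linarith)]
      calc y = expPenalty l (Real.log y + 1 - l) := hpen.symm
        _ ≤ _ := expPenalty_mono hz.le
    · unfold excessPenalty
      split_ifs
      · exact hy0.le
      · calc expPenalty l z ≤ expPenalty l (Real.log y + 1 - l) := expPenalty_mono hz
          _ = y := hpen
    · rw [hexp, ← hinv, add_sub_cancel_left, sub_mul, div_mul_cancel₀ _ hy0.ne', one_mul]

/-- This is consistency for a full advice load `A = 1`, the extreme case. -/
theorem integral_tradeoffPenalty_le (hl0 : 0 ≤ l) (hl : l < 1) {X : ℝ} (hX : 0 ≤ X) :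
    ∫ a in (0 : ℝ)..1, tradeoffPenalty l a X ≤
      Real.exp (l - 1) - l + ∫ x in (0 : ℝ)..X, tradeoffPenalty l 0 x := by
  have hi0 : ∀ a b, IntervalIntegrable (tradeoffPenalty l 0) MeasureTheory.volume a b :=
    fun a b => (tradeoffPenalty_mono hl0 hl 0).intervalIntegrable
  have hi : ∀ X a b, IntervalIntegrable (fun a => tradeoffPenalty l a X) MeasureTheory.volume a b :=
    fun X a b => (tradeoffPenalty_anti X).intervalIntegrable
  have he : ∀ a b, IntervalIntegrable (excessPenalty l) MeasureTheory.volume a b :=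
    fun a b => excessPenalty_mono.intervalIntegrable
  have main : ∀ X, 0 ≤ X → X ≤ 1 → ∫ a in (0 : ℝ)..1, tradeoffPenalty l a X ≤
      Real.exp (l - 1) - l + ∫ x in (0 : ℝ)..X, tradeoffPenalty l 0 x := by
    intro X hX hX1
    -- For advice loads below `X - ξ` the excess determines the penalty, above it `loadPenalty`
    -- does.
    obtain ⟨ξ, h0, h1, h2, h3, h4, h5, h6⟩ := exists_threshold hl0 hl hX hX1
    have e1 : ∫ a in (0 : ℝ)..(X - ξ), tradeoffPenalty l a X ≤ ∫ x in ξ..X, excessPenalty l x := by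
      have : ∫ a in (0 : ℝ)..(X - ξ), excessPenalty l (X - a) = ∫ x in ξ..X, excessPenalty l x := by
        rw [intervalIntegral.integral_comp_sub_left (fun x => excessPenalty l x)]
        simp
      rw [← this]
      refine intervalIntegral.integral_mono_on_of_le_Ioo (by linarith) (hi _ _ _)
        (Antitone.intervalIntegrable fun a b hab => excessPenalty_mono (by linarith))
        fun a ha => max_le le_rfl (h4 _ (by linarith [ha.2]))
    have e2 : ∫ a in (X - ξ)..1, tradeoffPenalty l a X ≤ (1 - (X - ξ)) * loadPenalty l X := by
      rw [← smul_eq_mul, ← intervalIntegral.integral_const]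
      exact intervalIntegral.integral_mono_on h3 (hi _ _ _) (by simp)
        fun a ha => max_le (h5 _ (by linarith [ha.1])) le_rfl
    have e3 : ∫ x in (0 : ℝ)..X, excessPenalty l x ≤ ∫ x in (0 : ℝ)..X, tradeoffPenalty l 0 x :=
      intervalIntegral.integral_mono_on hX (he _ _) (hi0 _ _) fun x _ => by
        rw [tradeoffPenalty, sub_zero]; exact le_max_left _ _
    have e4 := exp_sub_exp_le_integral_excessPenalty h0 h1
    rw [← intervalIntegral.integral_add_adjacent_intervals (he 0 ξ) (he ξ X)] at e3
    rw [← intervalIntegral.integral_add_adjacent_intervals (hi X 0 (X - ξ)) (hi X (X - ξ) 1)]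
    linarith
  rcases le_total X 1 with hX1 | hX1
  · exact main X hX hX1
  · have e1 : ∫ a in (0 : ℝ)..1, tradeoffPenalty l a X ≤ ∫ a in (0 : ℝ)..1, tradeoffPenalty l a 1 :=
      intervalIntegral.integral_mono_on zero_le_one (hi _ _ _) (hi _ _ _) fun a _ => by
        refine (tradeoffPenalty_le_one hl0 hl _ _).trans ?_
        exact (loadPenalty_of_one_le hl0 hl (le_refl (1 : ℝ))).ge.trans (le_max_right _ _)
    have e2 : 0 ≤ ∫ x in (1 : ℝ)..X, tradeoffPenalty l 0 x :=
      intervalIntegral.integral_nonneg hX1 fun x _ =>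
        (excessPenalty_nonneg _).trans (le_max_left _ _)
    have e3 := main 1 zero_le_one le_rfl
    rw [← intervalIntegral.integral_add_adjacent_intervals (hi0 0 1) (hi0 1 X)]
    linarith

/-- The part of `excessPenalty` above its initial jump is a lower bound for its integral. -/
theorem excess_jump_push (hl : l < 1) (z : ℝ) {h : ℝ} (hh : 0 ≤ h) :
    (if z + h ≤ 0 then 0 else expPenalty l (z + h) - Real.exp (l - 1)) ≤
      (if z ≤ 0 then 0 else expPenalty l z - Real.exp (l - 1)) + h * excessPenalty l (z + h) := by
  unfold excessPenalty
  split_ifs with h1 h2 h2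
  · simp
  · linarith
  · have h3 := expPenalty_add_sub_le (l := l) 0 (h := z + h) (by linarith)
    rw [zero_add, expPenalty_zero hl] at h3
    have h4 := mul_le_mul_of_nonneg_right (by linarith : z + h ≤ h)
      (expPenalty_nonneg (l := l) (z + h))
    linarith
  · have := expPenalty_add_sub_le (l := l) z hh
    linarith

/-- The penalty that trades consistency `c(l)` for robustness `r(l)`. -/
def tradeoffSystem (hl0 : 0 ≤ l) (hl : l < 1) :
    PenaltySystem (robustness l) (consistency l) 1 where
  f := tradeoffPenalty l
  -- The gain along `(0, 0)`, `(0, X)`, `(A, X)`: upward moves earn `f`, moves to the right earn `1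
  -- - f`.
  V A X := (∫ x in (0 : ℝ)..X, tradeoffPenalty l 0 x) + A
    - ∫ a in (0 : ℝ)..A, tradeoffPenalty l a X
  -- Two lower bounds for the credit: the rise of the exponential after its jump, which itself earns
  -- nothing, and the area under `loadPenalty`.
  W A X := max (if X - A ≤ 0 then 0 else expPenalty l (X - A) - Real.exp (l - 1))
    (levelCredit l (loadPenalty l X))
  f_nonneg A X := (excessPenalty_nonneg _).trans (le_max_left _ _)
  f_le_one := tradeoffPenalty_le_one hl0 hl
  f_mono := tradeoffPenalty_mono hl0 hl
  f_eq_one A X _ _ h := by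
    refine le_antisymm (tradeoffPenalty_le_one hl0 hl _ _) ?_
    rw [← loadPenalty_of_one_le hl0 hl h.le]
    exact le_max_right _ _
  V_zero := by simp
  V_push A X h hA _ _ hh := by
    have h1 := integral_exchange_le (tradeoffPenalty_mono hl0 hl) tradeoffPenalty_anti
      (tradeoffPenalty_diag hl0 hl) X hA hh
    have hi0 : ∀ a b, IntervalIntegrable (tradeoffPenalty l 0) MeasureTheory.volume a b :=
      fun a b => (tradeoffPenalty_mono hl0 hl 0).intervalIntegrable
    rw [← intervalIntegral.integral_add_adjacent_intervals (hi0 0 X) (hi0 X (X + h))]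
    linarith
  V_advice A A' X _ hAA _ _ := by
    have hi : ∀ a b, IntervalIntegrable (fun a => tradeoffPenalty l a X)
        MeasureTheory.volume a b := fun a b => (tradeoffPenalty_anti X).intervalIntegrable
    have h1 : (A' - A) * tradeoffPenalty l A' X ≤ ∫ a in A..A', tradeoffPenalty l a X := by
      rw [← smul_eq_mul, ← intervalIntegral.integral_const]
      exact intervalIntegral.integral_mono_on hAA (by simp) (hi _ _)
        fun a ha => tradeoffPenalty_anti X ha.2
    rw [← intervalIntegral.integral_add_adjacent_intervals (hi 0 A) (hi A A')]
    linarith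
  V_lower A X hA hA1 hX := by
    have hi : ∀ a b, IntervalIntegrable (fun a => tradeoffPenalty l a X)
        MeasureTheory.volume a b := fun a b => (tradeoffPenalty_anti X).intervalIntegrable
    have h1 := integral_tradeoffPenalty_le hl0 hl hX
    -- The penalty is at least `1 - c(l)` everywhere, which reduces all `A` to `A = 1`.
    have h2 : (1 - A) * (Real.exp (l - 1) - l) ≤ ∫ a in A..1, tradeoffPenalty l a X := by
      rw [← smul_eq_mul, ← intervalIntegral.integral_const]
      exact intervalIntegral.integral_mono_on hA1 (by simp) (hi _ _)
        fun a _ => le_tradeoffPenalty hl0 hl a X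
    rw [← intervalIntegral.integral_add_adjacent_intervals (hi 0 A) (hi A 1)] at h1
    unfold consistency
    linarith
  W_zero := by
    rw [sub_zero, if_pos le_rfl, loadPenalty_zero hl0 hl, levelCredit_start, max_self]
  W_push A X h _ _ _ hh := by
    have hf : ∀ {u v : ℝ}, u ≤ v → h * u ≤ h * v := fun huv => mul_le_mul_of_nonneg_left huv hh
    refine max_le ?_ ?_
    · have h1 := excess_jump_push hl (X - A) hh
      rw [show X + h - A = X - A + h by ring]
      refine h1.trans (add_le_add (le_max_left _ _) (hf ?_))
      rw [tradeoffPenalty, show X + h - A = X - A + h by ring]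
      exact le_max_left _ _
    · have h1 := levelCredit_sub_le hl (loadPenalty_pos hl0 hl X)
        (loadPenalty_mono hl0 hl (by linarith : X ≤ X + h))
      rw [(loadPenalty_spec hl0 hl X).2, (loadPenalty_spec hl0 hl (X + h)).2] at h1
      have h2 : max 0 (min 1 (X + h)) - max 0 (min 1 X) ≤ h := by
        rcases le_total 0 (min 1 (X + h)) with h3 | h3
        · rw [max_eq_right h3]
          have h4 : min 1 (X + h) ≤ min 1 X + h := by
            rw [← min_add_add_right]; exact min_le_min (by linarith) le_rfl
          have := le_max_right 0 (min 1 X)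
          linarith
        · rw [max_eq_left h3]
          have := le_max_left 0 (min 1 X)
          linarith
      have h3 := mul_le_mul_of_nonneg_left h2 (loadPenalty_pos hl0 hl (X + h)).le
      have h4 : h * loadPenalty l (X + h) ≤ h * tradeoffPenalty l A (X + h) :=
        hf (le_max_right _ _)
      have h5 := le_max_right (if X - A ≤ 0 then 0 else expPenalty l (X - A) - Real.exp (l - 1))
        (levelCredit l (loadPenalty l X))
      linarith
  W_advice A A' X _ hAA _ _ := by
    refine max_le_max ?_ le_rfl
    split_ifs with h1 h2 h2
    · exact le_rfl
    · rw [sub_nonneg, ← expPenalty_zero hl]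
      exact expPenalty_mono (by linarith)
    · linarith
    · exact sub_le_sub_right (expPenalty_mono (by linarith)) _
  W_lower A X _ _ _ := by
    unfold tradeoffPenalty
    rcases le_total (excessPenalty l (X - A)) (loadPenalty l X) with h1 | h1
    · rw [max_eq_right h1]
      obtain ⟨⟨hk, hy⟩, -⟩ := loadPenalty_spec hl0 hl X
      refine (robustness_le_levelCredit hl0 hl hk hy).trans ?_
      gcongr
      exact le_max_right _ _
    · rw [max_eq_left h1]
      have h2 := robustness_le_one_sub_exp hl0 hl
      have h3 := Real.exp_pos (l - 1)
      have h4 := le_max_left (if X - A ≤ 0 then 0 else expPenalty l (X - A) - Real.exp (l - 1))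
        (levelCredit l (loadPenalty l X))
      unfold excessPenalty
      split_ifs at h4 ⊢ <;> linarith

end Tradeoff

/-! ### Splitting impressions into parts: the fractional assignment -/

section Splitting

theorem sum_range_mul_add (F : ℕ → ℝ) (n N : ℕ) : ∑ i ∈ Finset.range (n * N), F i =
    ∑ v ∈ Finset.range n, ∑ j ∈ Finset.range N, F (v * N + j) := by
  induction n with
  | zero => simp
  | succ n ih => rw [Nat.succ_mul, Finset.sum_range_add, ih, Finset.sum_range_succ]

theorem mul_add_div_of_lt {N j : ℕ} (v : ℕ) (hj : j < N) : (v * N + j) / N = v := by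
  rw [Nat.mul_comm, Nat.mul_add_div (by omega), Nat.div_eq_of_lt hj, add_zero]

variable {ι : Type*}

/-- The bids on the parts of the impressions, when each impression is split into `N` parts. -/
def splitBid (N : ℕ) (b : ℕ → ι → ℝ) (i : ℕ) (u : ι) : ℝ := b (i / N) u / N

theorem adviceLoad_splitBid {N : ℕ} (hN : 0 < N) (b a : ℕ → ι → ℝ) (n : ℕ) (u : ι) :
    adviceLoad (splitBid N b) (fun i => a (i / N)) (n * N) u =
      ∑ v ∈ Finset.range n, b v u * a v u := by
  have hN' : (N : ℝ) ≠ 0 := by exact_mod_cast hN.ne'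
  rw [adviceLoad, sum_range_mul_add]
  refine Finset.sum_congr rfl fun v _ => ?_
  rw [Finset.sum_congr rfl (g := fun _ => b v u / N * a v u)]
  · rw [Finset.sum_const, Finset.card_range, nsmul_eq_mul]; field_simp
  · intro j hj
    rw [splitBid, mul_add_div_of_lt v (Finset.mem_range.1 hj)]

open Classical in
/-- The fraction of impression `v` that the greedy algorithm on the parts assigns to `u`. -/
def fraction (f : ℝ → ℝ → ℝ) (N : ℕ) (B : ι → ℝ) (b a : ℕ → ι → ℝ) (v : ℕ) (u : ι) : ℝ :=
  (∑ j ∈ Finset.range N,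
    if greedyPick f B (splitBid N b) (fun i => a (i / N)) (v * N + j) = some u then 1 else 0) / N

variable {f : ℝ → ℝ → ℝ} {N : ℕ} {B : ι → ℝ} {b a : ℕ → ι → ℝ}

theorem fraction_nonneg (v : ℕ) (u : ι) : 0 ≤ fraction f N B b a v u := by
  refine div_nonneg (Finset.sum_nonneg fun j _ => ?_) N.cast_nonneg
  split_ifs <;> norm_num

theorem sum_fraction_le_one [Fintype ι] (v : ℕ) : ∑ u, fraction f N B b a v u ≤ 1 := by
  classical
  unfold fraction
  rw [← Finset.sum_div, Finset.sum_comm]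
  refine div_le_one_of_le₀ ?_ N.cast_nonneg
  calc _ ≤ ∑ j ∈ Finset.range N, (1 : ℝ) := by
        gcongr with j _
        rcases greedyPick f B (splitBid N b) (fun i => a (i / N)) (v * N + j) with _ | u <;> simp
    _ = N := by simp

theorem fraction_congr {b' a' : ℕ → ι → ℝ} {v : ℕ} (hb : ∀ i ≤ v, b i = b' i)
    (ha : ∀ i ≤ v, a i = a' i) : fraction f N B b a v = fraction f N B b' a' v := by
  funext u
  unfold fraction
  congr 1
  refine Finset.sum_congr rfl fun j hj => ?_
  have hj := Finset.mem_range.1 hj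
  have hd : ∀ i ≤ v * N + j, i / N ≤ v := fun i hi => by
    rw [← mul_add_div_of_lt v hj]; exact Nat.div_le_div_right hi
  rw [greedyPick_congr (w' := splitBid N b') (a' := fun i => a' (i / N))]
  · intro i hi
    funext u
    rw [splitBid, splitBid, hb _ (hd i hi)]
  · intro i hi
    exact ha _ (hd i hi)

theorem greedyLoad_splitBid (n : ℕ) (u : ι) :
    greedyLoad f B (splitBid N b) (fun i => a (i / N)) (n * N) u =
      ∑ v ∈ Finset.range n, b v u * fraction f N B b a v u := by
  classical
  rw [greedyLoad_eq_sum, sum_range_mul_add]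
  refine Finset.sum_congr rfl fun v _ => ?_
  rw [fraction, ← mul_div_assoc, mul_div_right_comm, Finset.mul_sum]
  refine Finset.sum_congr rfl fun j hj => ?_
  rw [splitBid, mul_add_div_of_lt v (Finset.mem_range.1 hj), mul_ite, mul_one, mul_zero]

end Splitting

/-! ### The randomized online algorithm -/

section Rounding

open Classical in
/-- The probability mass function with the given real values, if they are a distribution. -/
def pmfOfReal {α : Type*} [Fintype α] (x₀ : α) (g : α → ℝ) : PMF α :=
  if h : (∀ x, 0 ≤ g x) ∧ ∑ x, g x = 1 then
    PMF.ofFintype (fun x => ENNReal.ofReal (g x)) (by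
      rw [← ENNReal.ofReal_sum_of_nonneg fun x _ => h.1 x, h.2, ENNReal.ofReal_one])
  else PMF.pure x₀

theorem toReal_pmfOfReal {α : Type*} [Fintype α] (x₀ : α) {g : α → ℝ} (h0 : ∀ x, 0 ≤ g x)
    (h1 : ∑ x, g x = 1) (x : α) : (pmfOfReal x₀ g x).toReal = g x := by
  unfold pmfOfReal
  rw [dif_pos ⟨h0, h1⟩, PMF.ofFintype_apply, ENNReal.toReal_ofReal (h0 x)]

/-- Choosing `u` with probability `q * x u`, and nothing otherwise. -/
def thinned {ι : Type*} [Fintype ι] (q : ℝ) (x : ι → ℝ) : Option ι → ℝ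
  | none => 1 - ∑ u, q * x u
  | some u => q * x u

variable {ι : Type*} [Fintype ι] {q : ℝ} {x : ι → ℝ}

theorem thinned_nonneg (hq0 : 0 ≤ q) (hq1 : q ≤ 1) (hx : ∀ u, 0 ≤ x u) (hx1 : ∑ u, x u ≤ 1)
    (y : Option ι) : 0 ≤ thinned q x y := by
  rcases y with _ | u
  · have : q * ∑ u, x u ≤ 1 := mul_le_one₀ hq1 (Finset.sum_nonneg fun u _ => hx u) hx1
    simpa [thinned, ← Finset.mul_sum] using this
  · exact mul_nonneg hq0 (hx u)

theorem sum_thinned (q : ℝ) (x : ι → ℝ) : ∑ y, thinned q x y = 1 := by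
  simp [Fintype.sum_option, thinned]

end Rounding

/-- Extension by zero of bids or advice that are known for finitely many impressions. -/
def extend {m k : ℕ} (b : Fin m → Fin k → ℝ) (v : ℕ) (u : Fin m) : ℝ :=
  if h : v < k then b u ⟨v, h⟩ else 0

theorem extend_apply {m k : ℕ} (b : Fin m → Fin k → ℝ) (v : Fin k) (u : Fin m) :
    extend b v u = b u v := dif_pos v.isLt

theorem extend_castLE {m n : ℕ} (b : Fin m → Fin n → ℝ) (v : Fin n) {i : ℕ} (hi : i ≤ v) :
    extend (fun u s => b u (Fin.castLE (Nat.succ_le_of_lt v.isLt) s)) i = extend b i := by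
  funext u
  unfold extend
  rw [dif_pos (Nat.lt_succ_of_le hi), dif_pos (lt_of_le_of_lt hi v.isLt)]
  rfl

/-- Independent rounding of the greedy fractional assignment. -/
def roundedGreedy (f : ℝ → ℝ → ℝ) (N : ℕ) (q : ℝ) : OnlineAlgorithm where
  choose _ t B bid advice _ :=
    pmfOfReal none (thinned q (fraction f N B (extend bid) (extend advice) t))

namespace Instance

variable {m n : ℕ} (I : Instance m n)

/-- The greedy fractional assignment. -/
def greedyFraction (f : ℝ → ℝ → ℝ) (N : ℕ) (v : Fin n) (u : Fin m) : ℝ :=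
  fraction f N I.budget (extend I.bid) (extend I.advice) v u

/-- The fractions depend on bids and advice only, so the decisions are independent; by
`fraction_congr` they can be computed from what has been revealed. -/
theorem runProb_roundedGreedy (f : ℝ → ℝ → ℝ) (N : ℕ) {q : ℝ} (hq0 : 0 ≤ q) (hq1 : q ≤ 1)
    (σ : Fin n → Option (Fin m)) :
    (roundedGreedy f N q).runProb I σ = ∏ v, thinned q (I.greedyFraction f N v) (σ v) := by
  refine Finset.prod_congr rfl fun v _ => ?_
  have h : (roundedGreedy f N q).step I σ v
      = pmfOfReal none (thinned q (I.greedyFraction f N v)) := by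
    unfold OnlineAlgorithm.step roundedGreedy greedyFraction
    dsimp only
    rw [fraction_congr (fun i hi => extend_castLE I.bid v hi)
      (fun i hi => extend_castLE I.advice v hi)]
  rw [h, toReal_pmfOfReal none _ (sum_thinned _ _)]
  exact thinned_nonneg hq0 hq1 (fraction_nonneg _) (sum_fraction_le_one _)

theorem revenue_nonneg (σ : Fin n → Option (Fin m)) : 0 ≤ I.revenue σ :=
  Finset.sum_nonneg fun u _ => I.spent_nonneg σ u n

theorem opt_nonneg : 0 ≤ I.opt :=
  (I.revenue_nonneg fun _ => none).trans (Finset.le_sup' I.revenue (Finset.mem_univ _))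

theorem adviceValue_nonneg : 0 ≤ I.adviceValue :=
  Finset.sum_nonneg fun u _ => Finset.sum_nonneg fun v _ =>
    mul_nonneg (I.bid_nonneg u v) (I.advice_nonneg u v)

end Instance

namespace OnlineAlgorithm

variable {alg : OnlineAlgorithm} {ε : ℝ}

theorem expectedRevenue_nonneg (alg : OnlineAlgorithm) {m n : ℕ} (I : Instance m n) :
    0 ≤ alg.expectedRevenue I :=
  Finset.sum_nonneg fun σ _ => mul_nonneg
    (Finset.prod_nonneg fun _ _ => ENNReal.toReal_nonneg) (I.revenue_nonneg σ)

theorem isRobust_zero (alg : OnlineAlgorithm) (ε : ℝ) : alg.IsRobust ε 0 := fun m n I _ => by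
  rw [zero_mul]; exact alg.expectedRevenue_nonneg I

theorem IsRobust.mono {ρ ρ' : ℝ} (h : alg.IsRobust ε ρ) (hρ : ρ' ≤ ρ) : alg.IsRobust ε ρ' :=
  fun m n I hI => (mul_le_mul_of_nonneg_right hρ I.opt_nonneg).trans (h m n I hI)

theorem IsConsistent.mono {κ κ' : ℝ} (h : alg.IsConsistent ε κ) (hκ : κ' ≤ κ) :
    alg.IsConsistent ε κ' :=
  fun m n I hI => (mul_le_mul_of_nonneg_right hκ I.adviceValue_nonneg).trans (h m n I hI)

end OnlineAlgorithm

theorem extend_nonneg {m k : ℕ} {b : Fin m → Fin k → ℝ} (hb : ∀ u v, 0 ≤ b u v) (i : ℕ)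
    (u : Fin m) : 0 ≤ extend b i u := by
  unfold extend; split_ifs
  exacts [hb _ _, le_rfl]

theorem sum_extend_le_one {m k : ℕ} {b : Fin m → Fin k → ℝ} (hb : ∀ v, ∑ u, b u v ≤ 1) (i : ℕ) :
    ∑ u, extend b i u ≤ 1 := by
  unfold extend
  by_cases h : i < k
  · simpa [h] using hb ⟨i, h⟩
  · simp [h]

theorem adviceLoad_splitBid_extend {m n N : ℕ} (hN : 0 < N) (b a : Fin m → Fin n → ℝ)
    (u : Fin m) : adviceLoad (splitBid N (extend b)) (fun i => extend a (i / N)) (n * N) u =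
      ∑ v, b u v * a u v := by
  rw [adviceLoad_splitBid hN, Finset.sum_range]
  simp only [extend_apply]

/-! ### Assembly and choice of parameters -/

/-- A penalty system yields a randomized online algorithm. -/
theorem PenaltySystem.exists_algorithm {r c : ℝ} (P : PenaltySystem r c 1) {N : ℕ} (hN : 0 < N)
    {e : ℝ} (he : 0 < e) (he4 : e ≤ 1 / 4) : ∃ alg : OnlineAlgorithm,
      alg.IsRobust (e ^ 2) ((1 - 2 * e) * (r - 1 / N)) ∧
      alg.IsConsistent (e ^ 2) ((1 - 2 * e) * (c - 1 / N)) := by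
  have hN' : (0 : ℝ) < N := by exact_mod_cast hN
  have hs : 0 ≤ e ^ 2 / N := by positivity
  set Q := P.smooth hN hs with hQ
  have hQs : ∀ A X h, h ≤ e ^ 2 / N → Q.f A (X + h) ≤ Q.f A X + 1 / N :=
    fun A X h hh => P.smooth_slow hN hs hh
  -- The budget excess caused by smoothing does not depend on `N`, whereas the error `1 / N` becomes
  -- arbitrarily small.
  have hcap : 1 + N * (e ^ 2 / N) = 1 + e ^ 2 := by field_simp
  have key : ∀ (m n : ℕ) (I : Instance m n), I.SmallBids (e ^ 2) →
      (1 - 2 * e) * ∑ u, greedyLoad Q.f I.budget (splitBid N (extend I.bid))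
        (fun i => extend I.advice (i / N)) (n * N) u ≤
        (roundedGreedy Q.f N (1 - e)).expectedRevenue I := by
    intro m n I hI
    have hw : ∀ t u, 0 ≤ splitBid N (extend I.bid) t u := fun t u =>
      div_nonneg (extend_nonneg I.bid_nonneg _ _) hN'.le
    have hload : ∀ u, greedyLoad Q.f I.budget (splitBid N (extend I.bid))
        (fun i => extend I.advice (i / N)) (n * N) u
        = ∑ v, I.bid u v * I.greedyFraction Q.f N v u := fun u => by
      rw [greedyLoad_splitBid, Finset.sum_range]
      simp only [extend_apply]
      rfl
    simp only [OnlineAlgorithm.expectedRevenue]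
    simp only [I.runProb_roundedGreedy Q.f N (by linarith : 0 ≤ 1 - e) (by linarith : 1 - e ≤ 1),
      hload]
    refine rounding_lower_bound I he he4 hI
      (fun v => thinned_nonneg (by linarith) (by linarith) (fraction_nonneg _)
        (sum_fraction_le_one _))
      (fun v => sum_thinned _ _) (fun v => fraction_nonneg _) (fun v u => rfl) fun u => ?_
    rcases (I.budget_nonneg u).eq_or_lt with hB | hB
    · have hb : ∀ v, I.bid u v = 0 := fun v =>
        le_antisymm (by simpa [← hB] using hI u v) (I.bid_nonneg u v)
      simp [hb, ← hB]
    · rw [← hload, ← hcap]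
      refine greedyLoad_le (P := Q) hw (fun t u => extend_nonneg I.advice_nonneg _ _) hB
        (by positivity) ?_
      rw [adviceLoad_splitBid_extend hN]
      exact I.advice_budget u
  have he2 : 0 ≤ 1 - 2 * e := by linarith
  refine ⟨roundedGreedy Q.f N (1 - e), fun m n I hI => ?_, fun m n I hI => ?_⟩ <;>
  · refine le_trans ?_ (key m n I hI)
    rw [mul_assoc]
    refine mul_le_mul_of_nonneg_left ?_ he2
    have hw : ∀ t u, 0 ≤ splitBid N (extend I.bid) t u := fun t u =>
      div_nonneg (extend_nonneg I.bid_nonneg _ _) hN'.le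
    have ha : ∀ t u, 0 ≤ extend I.advice (t / N) u := fun t u => extend_nonneg I.advice_nonneg _ _
    have hws : ∀ t u, splitBid N (extend I.bid) t u ≤ e ^ 2 / N * I.budget u := fun t u => by
      have : extend I.bid (t / N) u ≤ e ^ 2 * I.budget u := by
        unfold extend; split_ifs
        exacts [hI _ _, mul_nonneg (by positivity) (I.budget_nonneg u)]
      rw [splitBid, div_mul_eq_mul_div]
      gcongr
    have haB : ∀ u, adviceLoad (splitBid N (extend I.bid))
        (fun i => extend I.advice (i / N)) (n * N) u ≤ I.budget u := fun u => by
      rw [adviceLoad_splitBid_extend hN]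
      exact I.advice_budget u
    -- The first alternative proves robustness, comparing with the paid impressions of an optimal
    -- assignment; the second proves consistency.
    first
    | obtain ⟨σ, -, hσ⟩ := Finset.exists_mem_eq_sup' Finset.univ_nonempty I.revenue
      have hload : ∀ u, adviceLoad (splitBid N (extend I.bid))
          (fun i => extend (fun u v => I.paid σ v u) (i / N)) (n * N) u = I.spent σ u n :=
        fun u => by rw [adviceLoad_splitBid_extend hN, I.spent_eq_sum_paid]
      have h := robustness_greedy (P := Q) (T := n * N) hw ha I.budget_nonneg hws hQs haB
        (o := fun i => extend (fun u v => I.paid σ v u) (i / N))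
        (fun t u => extend_nonneg (fun u v => I.paid_nonneg σ v u) _ _)
        (fun t => sum_extend_le_one (fun v => I.sum_paid_le_one σ v) _)
        (fun u => by rw [hload]; exact I.spent_le_budget σ u n)
      simp only [hload] at h
      rw [Instance.opt, hσ]
      exact h
    | have h := consistency_greedy (P := Q) (T := n * N) hw ha I.budget_nonneg hws hQs
        (fun t => sum_extend_le_one I.advice_supply _) haB
      simp only [adviceLoad_splitBid_extend hN] at h
      exact h

theorem robustness_pos {l : ℝ} (hl0 : 0 ≤ l) (hl : l < 1) : 0 < robustness l := by
  have hk := exp_sub_pos hl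
  have h := exp_le_one_of_lt hl
  rw [← levelCredit_one hl0 hl, levelCredit]
  refine intervalIntegral.intervalIntegral_pos_of_pos_on
    (intervalIntegrable_mul_levelSlope hk one_pos) (fun t ht => ?_) ?_
  · have ht0 := hk.trans ht.1
    exact mul_pos ht0 (levelSlope_pos hl ht0)
  · rcases hl0.eq_or_lt with h0 | h0
    · rw [← h0, sub_zero, Real.exp_lt_one_iff]; norm_num
    · linarith

theorem consistency_pos {l : ℝ} (hl0 : 0 ≤ l) (hl : l ≤ 1) : 0 < consistency l := by
  unfold consistency
  have h : Real.exp (l - 1) ≤ 1 := Real.exp_le_one_iff.2 (by linarith)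
  rcases hl0.eq_or_lt with h0 | h0
  · have : Real.exp (0 - 1) < 1 := Real.exp_lt_one_iff.2 (by norm_num)
    rw [← h0]; linarith
  · linarith

/-- Since `1 / e ^ 2 ≥ 16`, the logarithm is at least 1 and can be dropped. -/
theorem smallBidsFactor_le {e : ℝ} (he : 0 < e) (he4 : e ≤ 1 / 4) :
    smallBidsFactor (e ^ 2) ≤ 1 - 3 * e := by
  have h1 : 1 ≤ Real.log (1 / e ^ 2) := by
    rw [Real.le_log_iff_exp_le (by positivity)]
    have h2 : (16 : ℝ) ≤ 1 / e ^ 2 := by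
      rw [le_div_iff₀ (by positivity)]; nlinarith
    linarith [Real.exp_one_lt_d9]
  have h2 : e ≤ √(e ^ 2 * Real.log (1 / e ^ 2)) := by
    refine Real.le_sqrt_of_sq_le ?_
    nlinarith [sq_nonneg e]
  unfold smallBidsFactor
  linarith

theorem mul_smallBidsFactor_le {κ η e : ℝ} (hκ : 0 ≤ κ) (he : 0 < e) (he4 : e ≤ 1 / 4)
    (hη : η ≤ e * κ) : κ * smallBidsFactor (e ^ 2) ≤ (1 - 2 * e) * (κ - η) := by
  calc κ * smallBidsFactor (e ^ 2) ≤ κ * (1 - 3 * e) := by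
        gcongr; exact smallBidsFactor_le he he4
    _ ≤ (1 - 2 * e) * (κ - e * κ) := by nlinarith [mul_nonneg hκ (sq_nonneg e)]
    _ ≤ (1 - 2 * e) * (κ - η) := by
        gcongr; linarith

end AdWords

end

theorem theorem2 :
    ∃ ε₀ : ℝ, 0 < ε₀ ∧ ∀ ε : ℝ, 0 < ε → ε ≤ ε₀ → ∀ l : ℝ, 0 ≤ l → l ≤ 1 →
      ∃ alg : AdWords.OnlineAlgorithm,
        alg.IsRobust ε (AdWords.robustness l * AdWords.smallBidsFactor ε) ∧
        alg.IsConsistent ε (AdWords.consistency l * AdWords.smallBidsFactor ε) := by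
  -- The bound `1 / 16` gives `√ε ≤ 1 / 4`, as rounding requires.
  refine ⟨1 / 16, by norm_num, fun ε hε hε0 l hl0 hl1 => ?_⟩
  obtain ⟨e, he, he4, rfl⟩ : ∃ e : ℝ, 0 < e ∧ e ≤ 1 / 4 ∧ ε = e ^ 2 := by
    refine ⟨√ε, Real.sqrt_pos.2 hε, ?_, (Real.sq_sqrt hε.le).symm⟩
    rw [Real.sqrt_le_iff]
    exact ⟨by norm_num, by linarith⟩
  have hc := AdWords.consistency_pos hl0 hl1
  rcases hl1.eq_or_lt with rfl | hl
  · have hr : AdWords.robustness 1 = 0 := by simp [AdWords.robustness]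
    have hc1 : AdWords.consistency 1 = 1 := by simp [AdWords.consistency]
    obtain ⟨N, hN⟩ := exists_nat_one_div_lt he
    obtain ⟨alg, -, h⟩ :=
      AdWords.PenaltySystem.followAdvice.exists_algorithm N.succ_pos he he4
    refine ⟨alg, ?_, h.mono ?_⟩
    · rw [hr, zero_mul]; exact alg.isRobust_zero _
    · rw [hc1]
      exact AdWords.mul_smallBidsFactor_le zero_le_one he he4 (by push_cast; linarith)
  · have hr := AdWords.robustness_pos hl0 hl
    -- The error `1 / (N + 1)` must be at most the fraction `e` of both ratios, which is possible
    -- because both are positive for `l < 1`.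
    obtain ⟨N, hN⟩ := exists_nat_one_div_lt (mul_pos he (lt_min hr hc))
    have h1 := mul_le_mul_of_nonneg_left (min_le_left (AdWords.robustness l)
      (AdWords.consistency l)) he.le
    have h2 := mul_le_mul_of_nonneg_left (min_le_right (AdWords.robustness l)
      (AdWords.consistency l)) he.le
    obtain ⟨alg, h, h'⟩ :=
      (AdWords.tradeoffSystem hl0 hl).exists_algorithm N.succ_pos he he4
    exact ⟨alg, h.mono (AdWords.mul_smallBidsFactor_le hr.le he he4 (by push_cast; linarith)),
      h'.mono (AdWords.mul_smallBidsFactor_le hc.le he he4 (by push_cast; linarith))⟩
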